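/- **Sequences.** Let $a=(a_j)_{j\ge 1}$ be a non-negative, non-increasing sequence with $\sum_j a_j=1$, and put $s_n=2^{-n}\sum_{j\ge 2^n}a_j$ for $n\ge 0$. Assume that $a$ is *level comparable*: it is doubling (there is $\kappa$ with $a_n\le\kappa a_{2n}$ for all $n\ge1$), and there are constants $\tau,\lambda$ with $0<\tau\le s_{j+1}/s_j\le\lambda<1/2$ for all $j$. **Dimensions.** Let $\Phi:(0,1)\to[0,\infty)$ be a dimension function, i.e. $R^{1+\Phi(R)}$ decreases (weakly) as $R$ decreases to $0$. For a bounded set $S\subseteq\mathbb R$ let $N_r(S)$ be the least number of balls of radius $r$ that cover $S$, and for bounded $E\subseteq\mathbb R$ let $$\overline{\dim}_\Phi E=\inf\Bigl\{\alpha:(\exists c_1,c_2>0)(\forall\,0<r\le R^{1+\Phi(R)}\le R<c_1)\ \sup_{x\in E}N_r(B(x,R)\cap E)\le c_2\Bigl(\frac Rr\Bigr)^{\alpha}\Bigr\},$$ where $R$ ranges over $(0,1)$. The *depth function* $\phi(n)$, $n\ge1$, is the least integer $j$ with $s_{n+j}\le s_n^{1+\Phi(s_n)}$. **The Cantor set.**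 Let $I^0_1=[0,1]$. Given the intervals $I^k_1,\dots,I^k_{2^k}$ of step $k$, remove from each $I^k_j$ an open interval of length $a_{2^k+j-1}$, placed so that the closed intervals $I^{k+1}_{2j-1}$ and $I^{k+1}_{2j}$ that remain on its left and right have lengths equal to the total lengths of the gaps that are removed from them at later steps. Put $C_a=\bigcap_{k\ge1}\bigcup_{j=1}^{2^k}I^k_j$. **Random rearrangements.** Let $\mathcal O$ be the set of all strict total orders on $\{1,2,3,\dots\}$, with the $\sigma$-algebra generated by the cylinder sets $\mathcal O_\triangleleft=\{\prec\,:\ \prec|_F=\triangleleft\}$ ($F$ finite, $\triangleleft$ a strict total order on $F$), and let $P$ be the probability measure on $\mathcal O$ with $P(\mathcal O_\triangleleft)=1/|F|!$ for all of them. Equivalently (Hawkes' model), $P$ is the law of the order given by $i\prec j\iff\omega_i<\omega_j$, for independent $\omega_1,\omega_2,\dots$ distributed uniformly on $[0,1]$. For $\prec\,\in\mathcal O$ put $$K_\prec=[0,1]\setminus\bigcup_{i\ge1}\Bigl(\sum_{j\prec i}a_j,\ a_i+\sum_{j\prec i}a_j\Bigr).$$ **Theorem.** Let $a$ be level comparable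 and let $\Phi$ be a dimension function. 1. $\dfrac{\log|\log x|}{|\log x|}=o(\Phi(x))$ as $x\to0^+$ if and only if $\log n=o(\phi(n))$ as $n\to\infty$. 2. If these equivalent conditions hold, then $\overline{\dim}_\Phi K_\prec=\overline{\dim}_\Phi C_a$ for $P$-almost every $\prec\,\in\mathcal O$. -/

import Mathlib

open MeasureTheory Filter Topology Asymptotics
open scoped ENNReal NNReal

namespace RandomRearrangement

noncomputable section

/-! ### Upper `Φ`-dimension -/

/-- `Φ : (0,1) → [0,∞)` is a dimension function if `R ^ (1 + Φ R)` decreases as `R` decreases to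
`0`. Only the values of `Φ` on `(0,1)` are constrained. -/
structure IsDimensionFunction (Φ : ℝ → ℝ) : Prop where
  nonneg : ∀ R ∈ Set.Ioo (0 : ℝ) 1, 0 ≤ Φ R
  monotone : MonotoneOn (fun R : ℝ => R ^ (1 + Φ R)) (Set.Ioo (0 : ℝ) 1)

/-- The condition on `α` in the definition of the upper `Φ`-dimension of `E`: there are
`c₁, c₂ > 0` with `N_r (B(x,R) ∩ E) ≤ c₂ (R / r) ^ α` for all `x ∈ E` and all
`0 < r ≤ R ^ (1 + Φ R) ≤ R < c₁`. Here `N_r S` is the least number of (closed) balls of radius `r`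
that cover `S`. The function `Φ` lives on `(0,1)`, so `R < 1`. -/
def UpperExponent {X : Type*} [PseudoMetricSpace X] (Φ : ℝ → ℝ) (E : Set X) (α : ℝ) : Prop :=
  ∃ c₁ > (0 : ℝ), ∃ c₂ > (0 : ℝ), ∀ R r : ℝ, 0 < R → R < 1 → R < c₁ → 0 < r →
    r ≤ R ^ (1 + Φ R) → R ^ (1 + Φ R) ≤ R → ∀ x ∈ E,
      (Metric.externalCoveringNumber r.toNNReal (Metric.closedBall x R ∩ E) : ℝ≥0∞) ≤
        ENNReal.ofReal (c₂ * (R / r) ^ α)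

/-- The upper `Φ`-dimension, as an infimum in the extended reals. -/
def upperDim {X : Type*} [PseudoMetricSpace X] (Φ : ℝ → ℝ) (E : Set X) : EReal :=
  ⨅ (α : ℝ) (_ : UpperExponent Φ E α), (α : EReal)

/-! ### Level comparable sequences

A sequence `a₁, a₂, …` is a function `a : ℕ → ℝ` of which only the values at `n ≥ 1` are used. -/

/-- `s_n = 2⁻ⁿ ∑_{j ≥ 2ⁿ} a_j`, the average length of the Cantor intervals of step `n`. -/
def avgLength (a : ℕ → ℝ) (n : ℕ) : ℝ :=
  (∑' j : ℕ, a (2 ^ n + j)) / 2 ^ n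

/-- `a` is non-negative, decreasing, has sum one, is doubling, and its average lengths satisfy
`0 < τ ≤ s_{j+1} / s_j ≤ lam < 1/2`. -/
structure IsLevelComparable (a : ℕ → ℝ) : Prop where
  nonneg : ∀ n : ℕ, 1 ≤ n → 0 ≤ a n
  antitone : AntitoneOn a (Set.Ici 1)
  hasSum : HasSum (fun i : ℕ+ => a i) 1
  doubling : ∃ κ : ℝ, ∀ n : ℕ, 1 ≤ n → a n ≤ κ * a (2 * n)
  ratio : ∃ τ lam : ℝ, 0 < τ ∧ lam < 1 / 2 ∧
    ∀ j : ℕ, τ ≤ avgLength a (j + 1) / avgLength a j ∧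
      avgLength a (j + 1) / avgLength a j ≤ lam

/-- The depth function: the minimal `j` with `s_{n+j} ≤ s_n ^ (1 + Φ(s_n))`. -/
def depth (a : ℕ → ℝ) (Φ : ℝ → ℝ) (n : ℕ) : ℕ :=
  sInf {j : ℕ | avgLength a (n + j) ≤ avgLength a n ^ (1 + Φ (avgLength a n))}

/-! ### The Cantor set associated with `a`

The Cantor intervals of step `k` are numbered from left to right by `j = 0, …, 2ᵏ - 1` (step `0`
being `[0,1]`). Out of the `j`-th interval of step `k` a gap of length `a_{2ᵏ + j}` is removed,
leaving the intervals number `2j` and `2j + 1` of step `k + 1`. -/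

/-- The length of the `j`-th Cantor interval of step `k`: the sum of the lengths of all the gaps
that are removed from it, those of step `k + i` being number `2ⁱ j, …, 2ⁱ j + 2ⁱ - 1`. -/
def cantorLength (a : ℕ → ℝ) (k j : ℕ) : ℝ :=
  ∑' i : ℕ, ∑ l ∈ Finset.range (2 ^ i), a (2 ^ (k + i) + 2 ^ i * j + l)

/-- The left end point of the `j`-th Cantor interval of step `k`: a left child starts where its
parent does, a right child starts after its left sibling and the removed gap. -/
def cantorLeft (a : ℕ → ℝ) : ℕ → ℕ → ℝ
  | 0, _ => 0
  | k + 1, j =>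
    cantorLeft a k (j / 2) +
      if j % 2 = 0 then 0 else cantorLength a (k + 1) (j - 1) + a (2 ^ k + j / 2)

/-- The `j`-th Cantor interval of step `k`. -/
def cantorInterval (a : ℕ → ℝ) (k j : ℕ) : Set ℝ :=
  Set.Icc (cantorLeft a k j) (cantorLeft a k j + cantorLength a k j)

/-- The Cantor set `C_a`. -/
def cantorSet (a : ℕ → ℝ) : Set ℝ :=
  ⋂ (k : ℕ) (_ : 1 ≤ k), ⋃ (j : ℕ) (_ : j < 2 ^ k), cantorInterval a k j

/-! ### Random total orders and random rearrangements -/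

/-- The set of all (strict) total orders on `{1, 2, 3, …}`. -/
def OrderSpace : Type :=
  {r : ℕ+ → ℕ+ → Prop // IsStrictTotalOrder ℕ+ r}

/-- The total orders whose restriction to the finite set `F` is `t`. -/
def cylinder (F : Finset ℕ+) (t : F → F → Prop) : Set OrderSpace :=
  {o | ∀ i j : F, o.1 i j ↔ t i j}

/-- The `σ`-algebra generated by the cylinders. -/
instance instMeasurableSpaceOrderSpace : MeasurableSpace OrderSpace :=
  MeasurableSpace.generateFrom
    {C | ∃ (F : Finset ℕ+) (t : F → F → Prop), IsStrictTotalOrder F t ∧ C = cylinder F t}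

/-- The order on `{1, 2, 3, …}` induced by labels `ω_i`: `i` comes before `j` if `ω_i < ω_j`.
Ties, which have probability zero, are broken by the usual order, so that every family of labels
gives a total order. -/
def orderOfLabels (ω : ℕ+ → unitInterval) : OrderSpace :=
  ⟨fun i j => ω i < ω j ∨ (ω i = ω j ∧ i < j),
    { trichotomous := fun i j h₁ h₂ => by
        simp only [not_or, not_and, not_lt] at h₁ h₂
        have e : ω i = ω j := le_antisymm h₂.1 h₁.1
        exact le_antisymm (h₂.2 e.symm) (h₁.2 e)
      irrefl := fun i h => by simp at h
      trans := fun i j k h₁ h₂ => by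
        rcases h₁ with h₁ | ⟨h₁, h₁'⟩ <;> rcases h₂ with h₂ | ⟨h₂, h₂'⟩
        · exact Or.inl (h₁.trans h₂)
        · exact Or.inl (h₂ ▸ h₁)
        · exact Or.inl (h₁ ▸ h₂)
        · exact Or.inr ⟨h₁.trans h₂, h₁'.trans h₂'⟩ }⟩

/-- The law of independent labels `ω_1, ω_2, …`, uniformly distributed on `[0,1]`. -/
def labelMeasure : Measure (ℕ+ → unitInterval) :=
  Measure.infinitePi fun _ => (volume : Measure unitInterval)

instance : IsProbabilityMeasure labelMeasure := by
  unfold labelMeasure; infer_instance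

/-- The law of the random total order that is induced by independent uniform labels. -/
def orderMeasure : Measure OrderSpace :=
  labelMeasure.map orderOfLabels

theorem measurable_orderOfLabels : Measurable orderOfLabels := by
  apply measurable_generateFrom
  rintro _ ⟨F, t, -, rfl⟩
  have : orderOfLabels ⁻¹' cylinder F t = ⋂ (i : F) (j : F),
      {ω | (ω i < ω j ∨ (ω i = ω j ∧ (i : ℕ+) < j)) ↔ t i j} := by
    ext ω; simp [cylinder, orderOfLabels]
  rw [this]
  refine MeasurableSet.iInter fun i => MeasurableSet.iInter fun j => ?_
  have h₁ : MeasurableSet {ω : ℕ+ → unitInterval | ω i < ω j} :=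
    measurableSet_lt (measurable_pi_apply _) (measurable_pi_apply _)
  have h₂ : MeasurableSet {ω : ℕ+ → unitInterval | ω i = ω j} :=
    measurableSet_eq_fun (measurable_pi_apply _) (measurable_pi_apply _)
  exact (h₁.union (h₂.inter (MeasurableSet.const _))).iff (MeasurableSet.const _)

instance : IsProbabilityMeasure orderMeasure :=
  Measure.isProbabilityMeasure_map measurable_orderOfLabels.aemeasurable

/-- Ties have probability zero. -/
theorem labels_ne {ι : Type*} {i j : ι} (h : i ≠ j) :
    (Measure.infinitePi fun _ : ι => (volume : Measure unitInterval)) {ω | ω i = ω j} = 0 := by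
  have hm : MeasurableSet {x : unitInterval × unitInterval | x.1 = x.2} :=
    measurableSet_eq_fun measurable_fst measurable_snd
  have e : {ω : ι → unitInterval | ω i = ω j} =
      (fun ω : ι → unitInterval => (ω i, ω j)) ⁻¹'
        {x : unitInterval × unitInterval | x.1 = x.2} := rfl
  rw [e, ← Measure.map_apply (by fun_prop) hm, Measure.infinitePi_map_eval_prod h,
    Measure.measure_prod_null hm]
  refine Filter.Eventually.of_forall fun x => ?_
  have : Prod.mk x ⁻¹' {x : unitInterval × unitInterval | x.1 = x.2} = {x} := by
    ext y; simp [eq_comm]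
  simp [this]

/-- Independent uniform labels are in increasing order with probability `1 / n!`. -/
theorem measure_strictMono (n : ℕ) :
    (Measure.infinitePi fun _ : Fin n => (volume : Measure unitInterval)) {x | StrictMono x} =
      ((n.factorial : ℕ) : ENNReal)⁻¹ := by
  set ν := Measure.infinitePi fun _ : Fin n => (volume : Measure unitInterval) with hν
  have hm : MeasurableSet {x : Fin n → unitInterval | StrictMono x} := by
    have : {x : Fin n → unitInterval | StrictMono x} = ⋂ (i) (j) (_ : i < j), {x | x i < x j} := by
      ext x; simp [StrictMono]
    rw [this]
    exact MeasurableSet.iInter fun i => MeasurableSet.iInter fun j => MeasurableSet.iInter fun _ =>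
      measurableSet_lt (measurable_pi_apply _) (measurable_pi_apply _)
  have hp : ∀ σ : Equiv.Perm (Fin n), Measurable fun (x : Fin n → unitInterval) i => x (σ i) := by
    intro σ; fun_prop
  have h1 : ∀ σ : Equiv.Perm (Fin n), ν {x | StrictMono (x ∘ σ)} = ν {x | StrictMono x} := by
    intro σ
    have := Measure.map_infinitePi_infinitePi_of_inj
      (P := fun _ : Fin n => (volume : Measure unitInterval)) σ.injective
    conv_rhs => rw [hν, ← this, Measure.map_apply (hp σ) hm]
    rfl
  have h2 : ∑ σ : Equiv.Perm (Fin n), ν {x | StrictMono (x ∘ σ)} = 1 := by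
    rw [← tsum_fintype (L := .unconditional _), ← measure_iUnion]
    · have : ν (⋃ σ : Equiv.Perm (Fin n), {x | StrictMono (x ∘ σ)})ᶜ = 0 := by
        refine measure_mono_null (t := ⋃ (i) (j) (_ : i ≠ j), {x | x i = x j}) ?_ ?_
        · intro x hx
          by_contra hc
          simp only [Set.mem_iUnion, Set.mem_ofPred_eq, not_exists] at hc
          apply hx
          simp only [Set.mem_iUnion, Set.mem_ofPred_eq]
          refine ⟨Tuple.sort x, (Tuple.monotone_sort x).strictMono_of_injective ?_⟩
          refine Function.Injective.comp ?_ (Tuple.sort x).injective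
          intro i j hij
          by_contra hne
          exact hc i j hne hij
        · simp only [measure_iUnion_null_iff]
          exact fun i j h => labels_ne h
      rw [← prob_compl_eq_zero_iff₀]
      · exact this
      · exact (MeasurableSet.iUnion fun σ => hp σ hm).nullMeasurableSet
    · intro σ τ hne
      refine Set.disjoint_left.2 fun x h1 h2 => hne ?_
      have e1 := Tuple.unique_monotone (StrictMono.monotone h1) (StrictMono.monotone h2)
      have hx : Function.Injective x := by
        have := h1.injective
        exact (Function.Injective.of_comp_iff' x σ.bijective).1 this
      ext i
      have := hx (congrFun e1 i)
      simp [this]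
    · exact fun σ => hp σ hm
  simp only [h1, Finset.sum_const, nsmul_eq_mul] at h2
  rw [Finset.card_univ, Fintype.card_perm, Fintype.card_fin] at h2
  rw [mul_comm] at h2
  exact ENNReal.eq_inv_of_mul_eq_one_left h2

/-- All orderings of a finite set `F` are equally likely: every cylinder over `F` has probability
`1 / |F|!`. The cylinders generate the `σ`-algebra, so this property determines the measure. -/
theorem orderMeasure_cylinder (F : Finset ℕ+) (t : F → F → Prop) (ht : IsStrictTotalOrder F t) :
    orderMeasure (cylinder F t) = ((F.card.factorial : ℕ) : ENNReal)⁻¹ := by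
  classical
  obtain ⟨e, he⟩ : ∃ e : Fin F.card ≃ F, ∀ k l, t (e k) (e l) ↔ k < l := by
    have key : ∀ (α : Type) [Fintype α] (t : α → α → Prop) (_ : IsStrictTotalOrder α t),
        ∃ e : Fin (Fintype.card α) ≃ α, ∀ k l, t (e k) (e l) ↔ k < l := by
      intro α _ t ht
      let _ : LinearOrder α := linearOrderOfSTO t
      let e : Fin (Fintype.card α) ≃o α := Fintype.orderIsoFinOfCardEq α rfl
      exact ⟨e.toEquiv, fun k l => e.lt_iff_lt⟩
    have := key F t ht
    rwa [Fintype.card_coe] at this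
  have hf : Function.Injective (fun k => (e k : ℕ+)) := Subtype.val_injective.comp e.injective
  rw [orderMeasure, Measure.map_apply measurable_orderOfLabels
    (MeasurableSpace.measurableSet_generateFrom ⟨F, t, ht, rfl⟩), ← measure_strictMono,
    ← Measure.map_infinitePi_infinitePi_of_inj (P := fun _ : ℕ+ => (volume : Measure unitInterval))
      hf]
  rw [Measure.map_apply₀ (Measurable.aemeasurable (by fun_prop))]
  · refine measure_congr ?_
    have : ∀ᵐ ω ∂labelMeasure, ∀ i j : ℕ+, i ≠ j → ω i ≠ ω j := by
      simp only [ae_all_iff]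
      intro i j h
      simpa [ae_iff, labelMeasure] using labels_ne h
    filter_upwards [this] with ω hω
    apply propext
    change (∀ i j : F, (ω i < ω j ∨ (ω i = ω j ∧ (i : ℕ+) < j)) ↔ t i j) ↔
      StrictMono fun k => ω (e k)
    constructor
    · intro h k l hkl
      rcases (h (e k) (e l)).2 ((he k l).2 hkl) with h' | h'
      · exact h'
      · exact absurd h'.1 (hω _ _ (fun hh => hkl.ne (hf hh)))
    · intro h i j
      obtain ⟨k, rfl⟩ := e.surjective i
      obtain ⟨l, rfl⟩ := e.surjective j
      rw [he, ← h.lt_iff_lt]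
      refine ⟨fun h' => h'.resolve_right ?_, Or.inl⟩
      rintro ⟨h1, h2⟩
      exact hω _ _ h2.ne h1
  · apply MeasurableSet.nullMeasurableSet
    have : {x : Fin F.card → unitInterval | StrictMono x} =
        ⋂ (i) (j) (_ : i < j), {x | x i < x j} := by
      ext x; simp [StrictMono]
    rw [this]
    exact MeasurableSet.iInter fun i => MeasurableSet.iInter fun j => MeasurableSet.iInter fun _ =>
      measurableSet_lt (measurable_pi_apply _) (measurable_pi_apply _)

/-- The left end point of the gap `i`: the total length of the gaps that come before it. -/
def gapLeft (a : ℕ → ℝ) (o : OrderSpace) (i : ℕ+) : ℝ :=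
  ∑' j : {j : ℕ+ // o.1 j i}, a (j : ℕ+)

/-- The rearrangement `[0, ∑ a_i] \ ⋃ J_i`, where `J_i` is the open interval of length `a_i` that
starts at the total length of the gaps that come before `i`. -/
def rearrangement (a : ℕ → ℝ) (o : OrderSpace) : Set ℝ :=
  Set.Icc 0 (∑' i : ℕ+, a i) \ ⋃ i : ℕ+, Set.Ioo (gapLeft a o i) (a i + gapLeft a o i)

end

end RandomRearrangement

/-!
Both dimensions are governed by the numbers `s_n`. Level comparability makes `a (2 ^ n)` comparable
with `s_n` and makes `2 ^ k * s_k` decay geometrically (`LevelBounds`). In particular `|log s_n|` is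
of order `n`, and `depth a Φ n` is of order `Φ (s_n) * |log s_n|` up to a bounded term, which gives
the equivalence of the two growth conditions; the monotonicity of `R ^ (1 + Φ R)` takes care of the
points between the `s_n` (`LevelBounds.isLittleO_iff_depth`).

For the dimensions, let `N` be the number of balls of radius about `s_{n+m}` that are needed to
cover the part of a set in a ball of radius about `s_n`. For the Cantor set `N` is of order `2 ^ m`
(`coverLower_cantorSet`, `coverUpper_cantorSet`). The growth condition says that `R / r` exceeds
every power of `|log R|`, that is of `n`, on the relevant scales, so two sets have the same upper
`Φ`-dimension as soon as their covering numbers agree up to powers of `n`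
(`LevelBounds.upperDim_le`). It remains to estimate `N` for a rearrangement.

* For every order, some ball needs about `2 ^ m` smaller ones (`coverLower_rearrangement`). Indeed,
  about `2 ^ n` balls of radius `s_n` cover the whole set, so one of them holds about `2 ^ m` of the
  `2 ^ (n + m)` gaps of step `n + m`.
* A ball of radius about `s_n` cannot contain a gap of a step before `n`, so all gaps in it lie
  between two consecutive ones of these `2 ^ n` long gaps. For random labels, such a stretch of the
  order has at most about `n ^ 2 * 2 ^ (k - n)` gaps of step `k`, for all `k ≥ n` and all large `n`
  almost surely (`ae_balancedOrder`): divide `[0,1]` into about `2 ^ n / n ^ 2` cells and apply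
  Borel-Cantelli to the events that a cell contains no long gap's label or too many labels of
  step `k`. Since the rearrangement is a null set, an `r`-separated subset of it is paid for by the
  gaps between its points (`card_mul_le_tsum`), and so `N` is at most about `n ^ 2 * 2 ^ m`
  (`coverUpper_rearrangement`).
-/

namespace RandomRearrangement

/-! ### Level comparable sequences -/

/-- The consequences of level comparability that the proof uses: the average lengths decay at a
rate between `τ` and `lam < 1/2`, and `a (2 ^ n)` is comparable with the average length of
step `n`. -/
structure LevelBounds (a : ℕ → ℝ) (τ lam : ℝ) : Prop where
  tau_pos : 0 < τ
  lam_lt : lam < 1 / 2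
  avg_zero : avgLength a 0 = 1
  avg_pos : ∀ n, 0 < avgLength a n
  le_avg_succ : ∀ n, τ * avgLength a n ≤ avgLength a (n + 1)
  avg_succ_le : ∀ n, avgLength a (n + 1) ≤ lam * avgLength a n
  mul_avg_le : ∀ n, (1 - 2 * lam) * avgLength a n ≤ a (2 ^ n)
  mul_le_avg : ∀ n, τ * a (2 ^ n) ≤ avgLength a n

namespace IsLevelComparable

variable {a : ℕ → ℝ} (ha : IsLevelComparable a)
include ha

theorem summable_add {N : ℕ} (hN : 1 ≤ N) : Summable fun j => a (N + j) := by
  have h1 : Summable fun n => a (n + 1) :=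
    summable_pnat_iff_summable_succ.1 ha.hasSum.summable
  obtain ⟨M, rfl⟩ := Nat.exists_eq_add_of_le hN
  refine ((summable_nat_add_iff M).2 h1).congr fun j => ?_
  congr 1; omega

theorem tsum_succ : ∑' j, a (1 + j) = 1 := by
  have h := tsum_pnat_eq_tsum_succ (f := a)
  rw [ha.hasSum.tsum_eq] at h
  rw [h]
  exact tsum_congr fun j => by rw [add_comm]

theorem tail_eq (n : ℕ) : ∑' j, a (2 ^ n + j) =
    ∑ j ∈ Finset.range (2 ^ n), a (2 ^ n + j) + ∑' j, a (2 ^ (n + 1) + j) := by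
  rw [← (ha.summable_add Nat.one_le_two_pow).sum_add_tsum_nat_add (2 ^ n)]
  congr 1
  refine tsum_congr fun j => ?_
  congr 1; ring

theorem antitone_of_le {i j : ℕ} (hi : 1 ≤ i) (hij : i ≤ j) : a j ≤ a i :=
  ha.antitone hi (hi.trans hij) hij

theorem exists_levelBounds : ∃ τ lam, LevelBounds a τ lam := by
  obtain ⟨τ, lam, hτ, hlam, h⟩ := ha.ratio
  have h0 : avgLength a 0 = 1 := by simp [avgLength, ha.tsum_succ]
  have hne : ∀ n, avgLength a n ≠ 0 := fun n hn => by
    have := (h n).1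
    rw [hn, div_zero] at this
    linarith
  have hpos : ∀ n, 0 < avgLength a n := fun n => by
    refine lt_of_le_of_ne ?_ (hne n).symm
    exact div_nonneg (tsum_nonneg fun j => ha.nonneg _
      (by have := Nat.one_le_two_pow (n := n); omega)) (by positivity)
  have h1 : ∀ n, τ * avgLength a n ≤ avgLength a (n + 1) := fun n =>
    (le_div_iff₀ (hpos n)).1 (h n).1
  have h2 : ∀ n, avgLength a (n + 1) ≤ lam * avgLength a n := fun n =>
    (div_le_iff₀ (hpos n)).1 (h n).2
  have h3 : ∀ n, avgLength a n = (∑ j ∈ Finset.range (2 ^ n), a (2 ^ n + j)) / 2 ^ n +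
      2 * avgLength a (n + 1) := fun n => by
    rw [avgLength, ha.tail_eq n, avgLength, add_div]
    congr 1
    rw [pow_succ]
    field_simp
    ring
  have h4 : ∀ n, (∑ j ∈ Finset.range (2 ^ n), a (2 ^ n + j)) / 2 ^ n ≤ a (2 ^ n) := fun n => by
    rw [div_le_iff₀ (by positivity)]
    calc _ ≤ ∑ j ∈ Finset.range (2 ^ n), a (2 ^ n) :=
          Finset.sum_le_sum fun j _ => ha.antitone_of_le Nat.one_le_two_pow (by omega)
      _ = _ := by simp [mul_comm]
  have h5 : ∀ n, a (2 ^ (n + 1)) ≤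
      (∑ j ∈ Finset.range (2 ^ n), a (2 ^ n + j)) / 2 ^ n := fun n => by
    rw [le_div_iff₀ (by positivity)]
    calc a (2 ^ (n + 1)) * 2 ^ n = ∑ j ∈ Finset.range (2 ^ n), a (2 ^ (n + 1)) := by
          simp [mul_comm]
      _ ≤ _ := Finset.sum_le_sum fun j hj => ha.antitone_of_le
          (by have := Nat.one_le_two_pow (n := n); omega)
          (by have := Finset.mem_range.1 hj; rw [pow_succ]; omega)
  refine ⟨τ, lam, hτ, hlam, h0, hpos, h1, h2, fun n => ?_, fun n => ?_⟩
  · have := h3 n; have := h4 n; have := h2 n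
    linarith
  · cases n with
    | zero =>
      have hle : a 1 ≤ 1 := by
        rw [← ha.tsum_succ]
        exact (ha.summable_add le_rfl).le_tsum 0 fun j _ => ha.nonneg _ (by omega)
      have : τ ≤ 1 := by
        have := h1 0; have := h2 0; nlinarith [hpos 0]
      rw [h0, pow_zero]
      nlinarith [ha.nonneg 1 le_rfl]
    | succ n =>
      have := h3 n; have := h5 n; have := h1 n; have := hpos (n + 1)
      nlinarith

end IsLevelComparable

namespace LevelBounds

variable {a : ℕ → ℝ} {τ lam : ℝ} (hb : LevelBounds a τ lam)
include hb

theorem tau_le : τ ≤ lam := by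
  have := hb.le_avg_succ 0; have := hb.avg_succ_le 0; have := hb.avg_pos 0
  exact le_of_mul_le_mul_right (by linarith) this

theorem lam_pos : 0 < lam := hb.tau_pos.trans_le hb.tau_le

theorem tau_lt_one : τ < 1 := by
  have := hb.tau_le; have := hb.lam_lt; linarith

theorem pos (n : ℕ) : 0 < a (2 ^ n) :=
  (mul_pos (by have := hb.lam_lt; linarith) (hb.avg_pos n)).trans_le (hb.mul_avg_le n)

theorem pow_mul_avg_le (n m : ℕ) : τ ^ m * avgLength a n ≤ avgLength a (n + m) := by
  induction m with
  | zero => simp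
  | succ m ih =>
    refine le_trans ?_ (hb.le_avg_succ (n + m))
    rw [pow_succ]
    nlinarith [hb.tau_pos]

theorem avg_le_pow_mul (n m : ℕ) : avgLength a (n + m) ≤ lam ^ m * avgLength a n := by
  induction m with
  | zero => simp
  | succ m ih =>
    refine (hb.avg_succ_le (n + m)).trans ?_
    rw [pow_succ]
    nlinarith [hb.lam_pos]

theorem strictAnti_avg : StrictAnti (avgLength a) := strictAnti_nat_of_succ_lt fun n => by
  have := hb.avg_succ_le n; have := hb.lam_lt; have := hb.avg_pos n
  nlinarith

theorem avg_le_one (n : ℕ) : avgLength a n ≤ 1 := by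
  rw [← hb.avg_zero]; exact hb.strictAnti_avg.antitone (Nat.zero_le n)

theorem avg_le_pow (n : ℕ) : avgLength a n ≤ lam ^ n := by
  simpa [hb.avg_zero] using hb.avg_le_pow_mul 0 n

theorem tendsto_avg : Tendsto (avgLength a) atTop (𝓝 0) :=
  squeeze_zero (fun n => (hb.avg_pos n).le) hb.avg_le_pow
    (tendsto_pow_atTop_nhds_zero_of_lt_one hb.lam_pos.le (by have := hb.lam_lt; linarith))

/-- Every small positive number lies between two consecutive average lengths. -/
theorem exists_avg_lt_le {x : ℝ} (hx : 0 < x) (hx1 : x ≤ 1) :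
    ∃ n, avgLength a (n + 1) < x ∧ x ≤ avgLength a n := by
  have hex : ∃ n, avgLength a n < x := (hb.tendsto_avg.eventually (gt_mem_nhds hx)).exists
  classical
  obtain ⟨n, hn⟩ : ∃ n, Nat.find hex = n + 1 := by
    refine Nat.exists_eq_succ_of_ne_zero fun h0 => ?_
    have := Nat.find_spec hex
    rw [h0, hb.avg_zero] at this
    linarith
  refine ⟨n, hn ▸ Nat.find_spec hex, not_lt.1 (Nat.find_min hex (by omega))⟩

theorem level_term_le (N i : ℕ) :
    2 ^ i * a (2 ^ (N + i)) ≤ (avgLength a N / τ) * (2 * lam) ^ i := by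
  have h1 := hb.mul_le_avg (N + i)
  have h2 := hb.avg_le_pow_mul N i
  rw [mul_pow, div_mul_eq_mul_div, le_div_iff₀ hb.tau_pos]
  have : (0 : ℝ) < 2 ^ i := by positivity
  nlinarith

theorem summable_level (N : ℕ) : Summable fun i => 2 ^ i * a (2 ^ (N + i)) := by
  have := hb.lam_pos; have := hb.lam_lt
  refine Summable.of_nonneg_of_le (fun i => mul_nonneg (by positivity) (hb.pos _).le)
    (hb.level_term_le N) ((summable_geometric_of_lt_one (by linarith) (by linarith)).mul_left _)

/-- The gaps of step at least `N` contribute at most a constant times `s_N` to one Cantor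
interval of step `N`, as `2 s_{k+1} / s_k` is bounded away from `1`. -/
theorem tsum_level_le (N : ℕ) :
    ∑' i, 2 ^ i * a (2 ^ (N + i)) ≤ avgLength a N / (τ * (1 - 2 * lam)) := by
  have := hb.lam_pos; have := hb.lam_lt
  calc _ ≤ ∑' i, (avgLength a N / τ) * (2 * lam) ^ i :=
        (hb.summable_level N).tsum_le_tsum (hb.level_term_le N)
          ((summable_geometric_of_lt_one (by linarith) (by linarith)).mul_left _)
    _ = _ := by
        rw [tsum_mul_left, tsum_geometric_of_lt_one (by linarith) (by linarith), div_mul_eq_div_div]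
        rfl

end LevelBounds

/-! ### The depth function -/

theorem isLittleO_iff_forall_mul_le {α : Type*} {l : Filter α} {f g : α → ℝ}
    (hf : ∀ᶠ x in l, 0 ≤ f x) (hg : ∀ᶠ x in l, 0 ≤ g x) :
    f =o[l] g ↔ ∀ K : ℝ, ∀ᶠ x in l, K * f x ≤ g x := by
  rw [isLittleO_iff]
  constructor
  · intro h K
    rcases le_or_gt K 0 with hK | hK
    · filter_upwards [hf, hg] with x h1 h2
      nlinarith
    · filter_upwards [hf, hg, h (inv_pos.2 hK)] with x h1 h2 h3
      rw [Real.norm_of_nonneg h1, Real.norm_of_nonneg h2] at h3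
      calc K * f x ≤ K * (K⁻¹ * g x) := by gcongr
        _ = g x := by field_simp
  · intro h c hc
    filter_upwards [hf, hg, h c⁻¹] with x h1 h2 h3
    rw [Real.norm_of_nonneg h1, Real.norm_of_nonneg h2]
    rw [inv_mul_le_iff₀ hc] at h3
    exact h3

theorem eventually_mem_Ioo {ε : ℝ} (hε : 0 < ε) : ∀ᶠ x : ℝ in 𝓝[>] 0, x ∈ Set.Ioo 0 ε :=
  Ioo_mem_nhdsGT hε

theorem eventually_le_neg_log (M : ℝ) : ∀ᶠ x : ℝ in 𝓝[>] 0, M ≤ -Real.log x :=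
  (tendsto_neg_atBot_atTop.comp Real.tendsto_log_nhdsGT_zero).eventually_ge_atTop M

theorem IsDimensionFunction.isLittleO_iff {Φ : ℝ → ℝ} (hΦ : IsDimensionFunction Φ) :
    (fun x : ℝ => Real.log |Real.log x| / |Real.log x|) =o[𝓝[>] 0] Φ ↔
      ∀ K : ℝ, ∀ᶠ x in 𝓝[>] 0, K * Real.log (-Real.log x) ≤ Φ x * -Real.log x := by
  rw [isLittleO_iff_forall_mul_le]
  · refine forall_congr' fun K => eventually_congr ?_
    filter_upwards [eventually_mem_Ioo one_pos] with x hx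
    have : Real.log x < 0 := Real.log_neg hx.1 hx.2
    rw [abs_of_neg this, ← mul_div_assoc, div_le_iff₀ (by linarith)]
  · filter_upwards [eventually_le_neg_log 1] with x hx
    have : 1 ≤ |Real.log x| := hx.trans (neg_le_abs _)
    exact div_nonneg (Real.log_nonneg this) (by positivity)
  · filter_upwards [eventually_mem_Ioo one_pos] with x hx using hΦ.nonneg x hx

namespace LevelBounds

variable {a : ℕ → ℝ} {τ lam : ℝ} (hb : LevelBounds a τ lam) {Φ : ℝ → ℝ}
include hb

theorem neg_log_lam_pos : 0 < -Real.log lam := by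
  have := Real.log_neg hb.lam_pos (by have := hb.lam_lt; linarith)
  linarith

theorem neg_log_tau_pos : 0 < -Real.log τ := by
  have := Real.log_neg hb.tau_pos hb.tau_lt_one
  linarith

theorem avg_mem_Ioo {n : ℕ} (hn : 1 ≤ n) : avgLength a n ∈ Set.Ioo (0 : ℝ) 1 :=
  ⟨hb.avg_pos n, by rw [← hb.avg_zero]; exact hb.strictAnti_avg hn⟩

theorem tendsto_avg_nhdsGT : Tendsto (avgLength a) atTop (𝓝[>] 0) :=
  tendsto_nhdsWithin_iff.2 ⟨hb.tendsto_avg, Eventually.of_forall hb.avg_pos⟩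

theorem log_avg_add_ge (n m : ℕ) :
    m * Real.log τ + Real.log (avgLength a n) ≤ Real.log (avgLength a (n + m)) := by
  rw [← Real.log_pow, ← Real.log_mul (pow_pos hb.tau_pos m).ne' (hb.avg_pos n).ne']
  exact Real.log_le_log (mul_pos (pow_pos hb.tau_pos m) (hb.avg_pos n)) (hb.pow_mul_avg_le n m)

theorem log_avg_add_le (n m : ℕ) :
    Real.log (avgLength a (n + m)) ≤ m * Real.log lam + Real.log (avgLength a n) := by
  rw [← Real.log_pow, ← Real.log_mul (pow_pos hb.lam_pos m).ne' (hb.avg_pos n).ne']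
  exact Real.log_le_log (hb.avg_pos _) (hb.avg_le_pow_mul n m)

theorem mul_le_neg_log_avg (n : ℕ) : n * -Real.log lam ≤ -Real.log (avgLength a n) := by
  have := hb.log_avg_add_le 0 n
  rw [hb.avg_zero, Real.log_one, zero_add] at this
  linarith

theorem neg_log_avg_le_mul (n : ℕ) : -Real.log (avgLength a n) ≤ n * -Real.log τ := by
  have := hb.log_avg_add_ge 0 n
  rw [hb.avg_zero, Real.log_one, zero_add] at this
  linarith

theorem avg_depth_le (n : ℕ) :
    avgLength a (n + depth a Φ n) ≤ avgLength a n ^ (1 + Φ (avgLength a n)) := by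
  have h : ∃ j, avgLength a (n + j) ≤ avgLength a n ^ (1 + Φ (avgLength a n)) := by
    have h1 := hb.tendsto_avg.comp (tendsto_add_atTop_nat n)
    obtain ⟨j, hj⟩ := (h1.eventually (gt_mem_nhds
      (Real.rpow_pos_of_pos (hb.avg_pos n) (1 + Φ (avgLength a n))))).exists
    exact ⟨j, by rw [add_comm]; exact hj.le⟩
  exact Nat.sInf_mem (s := {j | avgLength a (n + j) ≤ _}) h

theorem mul_neg_log_avg_le_depth (n : ℕ) :
    Φ (avgLength a n) * -Real.log (avgLength a n) ≤ -Real.log τ * depth a Φ n := by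
  have h1 := Real.log_le_log (hb.avg_pos _) (hb.avg_depth_le (Φ := Φ) n)
  rw [Real.log_rpow (hb.avg_pos n)] at h1
  have h2 := hb.log_avg_add_ge n (depth a Φ n)
  linarith

theorem depth_le (hΦ : IsDimensionFunction Φ) {n : ℕ} (hn : 1 ≤ n) :
    -Real.log lam * depth a Φ n ≤
      Φ (avgLength a n) * -Real.log (avgLength a n) + -Real.log lam := by
  have hs := hb.avg_mem_Ioo hn
  rcases Nat.eq_zero_or_eq_succ_pred (depth a Φ n) with h0 | h0
  · rw [h0, Nat.cast_zero, mul_zero]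
    exact add_nonneg (mul_nonneg (hΦ.nonneg _ hs) (neg_nonneg.2 (Real.log_neg hs.1 hs.2).le))
      hb.neg_log_lam_pos.le
  · set d := (depth a Φ n).pred
    have h1 : d ∉ {j | avgLength a (n + j) ≤ avgLength a n ^ (1 + Φ (avgLength a n))} :=
      Nat.notMem_of_lt_sInf (by change d < depth a Φ n; omega)
    have h2 := Real.log_le_log (Real.rpow_pos_of_pos hs.1 _) (not_le.1 h1).le
    rw [Real.log_rpow hs.1] at h2
    have h3 := hb.log_avg_add_le n d
    rw [h0]
    push_cast
    linarith

/-- Up to bounded factors and bounded terms, `depth a Φ n` is `Φ x * |log x|` at `x = s_n`, and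
`n` is `|log x|`; the monotonicity of `R ^ (1 + Φ R)` carries this over to the points `x`
between the average lengths. -/
theorem isLittleO_iff_depth (hΦ : IsDimensionFunction Φ) :
    (fun x : ℝ => Real.log |Real.log x| / |Real.log x|) =o[𝓝[>] 0] Φ ↔
      (fun n : ℕ => Real.log n) =o[atTop] (fun n : ℕ => (depth a Φ n : ℝ)) := by
  have hlam := hb.neg_log_lam_pos
  have htau := hb.neg_log_tau_pos
  have hlog : Tendsto (fun n : ℕ => Real.log n) atTop atTop :=
    Real.tendsto_log_atTop.comp tendsto_natCast_atTop_atTop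
  rw [hΦ.isLittleO_iff, isLittleO_iff_forall_mul_le
    (Eventually.of_forall fun n => Real.log_natCast_nonneg n)
    (Eventually.of_forall fun n => Nat.cast_nonneg _)]
  constructor
  · intro h K
    wlog hK : 0 ≤ K generalizing K
    · filter_upwards [this 0 le_rfl] with n hn
      nlinarith [Real.log_natCast_nonneg n]
    filter_upwards [hb.tendsto_avg_nhdsGT.eventually (h (2 * K * -Real.log τ)),
      eventually_ge_atTop 1, hlog.eventually_ge_atTop (-2 * Real.log (-Real.log lam))]
      with n h1 hn h2
    have hn' : (0 : ℝ) < n := by exact_mod_cast hn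
    have h3 := Real.log_le_log (by positivity) (hb.mul_le_neg_log_avg n)
    rw [Real.log_mul hn'.ne' hlam.ne'] at h3
    have h4 := hb.mul_neg_log_avg_le_depth (Φ := Φ) n
    have h5 : Real.log n / 2 ≤ Real.log (-Real.log (avgLength a n)) := by linarith
    have h6 : -Real.log τ * (K * Real.log n) ≤ -Real.log τ * depth a Φ n := by
      have : 2 * K * -Real.log τ * (Real.log n / 2) ≤
          2 * K * -Real.log τ * Real.log (-Real.log (avgLength a n)) := by gcongr
      linarith
    exact le_of_mul_le_mul_left h6 htau
  · intro h K
    wlog hK : 0 ≤ K generalizing K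
    · filter_upwards [this 0 le_rfl, eventually_le_neg_log 1] with x hx hx1
      nlinarith [Real.log_nonneg hx1]
    -- the bound at `s_n`, with room for the passage to `x ∈ (s_{n+1}, s_n]`
    have key : ∀ᶠ n : ℕ in atTop, K * Real.log ((n + 1) * -Real.log τ) ≤
        -Real.log lam * depth a Φ n - -Real.log lam - -Real.log τ := by
      filter_upwards [h ((2 * K + 1) / -Real.log lam), eventually_ge_atTop 1,
        hlog.eventually_ge_atTop (Real.log 2 + Real.log (-Real.log τ)),
        hlog.eventually_ge_atTop (-Real.log lam + -Real.log τ)] with n h1 hn h2 h3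
      have hn' : (1 : ℝ) ≤ n := by exact_mod_cast hn
      rw [div_mul_eq_mul_div, div_le_iff₀ hlam] at h1
      have h4 : Real.log ((n + 1) * -Real.log τ) ≤ 2 * Real.log n := by
        rw [Real.log_mul (by positivity) htau.ne']
        have : Real.log (n + 1) ≤ Real.log (2 * n) :=
          Real.log_le_log (by positivity) (by linarith)
        rw [Real.log_mul two_ne_zero (by positivity)] at this
        linarith
      nlinarith
    obtain ⟨n₀, hn₀⟩ := eventually_atTop.1 key
    filter_upwards [eventually_mem_Ioo (hb.avg_pos (n₀ + 2)), eventually_le_neg_log 1]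
      with x hx hx1
    have hx2 : x ≤ 1 := hx.2.le.trans (hb.avg_le_one _)
    obtain ⟨n, h1, h2⟩ := hb.exists_avg_lt_le hx.1 hx2
    have hn : n₀ + 1 ≤ n := by
      have := hb.strictAnti_avg.lt_iff_gt.1 (h1.trans hx.2)
      omega
    have hs := hb.avg_mem_Ioo (n := n) (by omega)
    have hmono := hΦ.monotone ⟨hx.1, h2.trans_lt hs.2⟩ hs h2
    have h3 := Real.log_le_log (Real.rpow_pos_of_pos hx.1 _) hmono
    rw [Real.log_rpow hx.1, Real.log_rpow hs.1] at h3
    have h4 := Real.log_le_log (hb.avg_pos _) h1.le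
    have h5 := hb.log_avg_add_ge n 1
    have h6 := hb.depth_le hΦ (n := n) (by omega)
    have h7 := hb.neg_log_avg_le_mul (n + 1)
    have h8 : Real.log (-Real.log x) ≤ Real.log ((n + 1) * -Real.log τ) :=
      Real.log_le_log (by linarith) (by push_cast at h7; linarith)
    have h9 := hn₀ n (by omega)
    have h10 : K * Real.log (-Real.log x) ≤ K * Real.log ((n + 1) * -Real.log τ) := by gcongr
    push_cast at h5
    linarith

end LevelBounds

/-! ### Comparison of upper `Φ`-dimensions through covering numbers -/

/-- Some ball of radius about `s_n` needs at least about `2 ^ m` balls of radius about `s_{n+m}`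
to cover its part of `E`. -/
def CoverLower (a : ℕ → ℝ) (E : Set ℝ) : Prop :=
  ∃ c : ℝ, 0 < c ∧ ∀ n m : ℕ, ∀ R r : ℝ, avgLength a n ≤ c * R → 0 < r →
    r ≤ c * avgLength a (n + m) → ∃ x ∈ E, ENNReal.ofReal (c * 2 ^ m) ≤
      (Metric.externalCoveringNumber r.toNNReal (Metric.closedBall x R ∩ E) : ℝ≥0∞)

/-- For large `n`, every ball of radius about `s_n` needs at most about `n ^ 2 * 2 ^ m` balls of
radius about `s_{n+m}` to cover its part of `E`. The factor `n ^ 2` leaves room for random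
fluctuations; any power of `n` would do. -/
def CoverUpper (a : ℕ → ℝ) (E : Set ℝ) : Prop :=
  ∃ C : ℝ, 1 ≤ C ∧ ∃ n₀ : ℕ, ∀ n ≥ n₀, ∀ m : ℕ, ∀ R r : ℝ, C * R ≤ avgLength a n →
    C * avgLength a (n + m) ≤ r → ∀ x ∈ E,
      (Metric.externalCoveringNumber r.toNNReal (Metric.closedBall x R ∩ E) : ℝ≥0∞) ≤
        ENNReal.ofReal (C * (n + 1) ^ 2 * 2 ^ m)

namespace LevelBounds

variable {a : ℕ → ℝ} {τ lam : ℝ} (hb : LevelBounds a τ lam) {Φ : ℝ → ℝ} {E F : Set ℝ}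
include hb

/-- The bound on `Φ` makes `R / r ≥ R ^ (-Φ R)` larger than every power of `|log R|`, hence of `n`
when `R` is about `s_n`. So the factor `n ^ 2` in `CoverUpper` costs an arbitrarily small
increase of the exponent. -/
theorem upperExponent_of_lt
    (hΦ : ∀ K : ℝ, ∀ᶠ x in 𝓝[>] 0, K * Real.log (-Real.log x) ≤ Φ x * -Real.log x)
    (hE : CoverLower a E) (hF : CoverUpper a F) {α β : ℝ} (hα : UpperExponent Φ E α)
    (hαβ : α < β) : UpperExponent Φ F β := by
  obtain ⟨c, hc, hE⟩ := hE
  obtain ⟨C, hC, n₀, hF⟩ := hF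
  obtain ⟨c₁, hc₁, c₂, hc₂, hα⟩ := hα
  have hC0 : 0 < C := by linarith
  have hlam := hb.neg_log_lam_pos
  obtain ⟨h, hh⟩ : ∃ h : ℕ, lam ^ h < c / C := exists_pow_lt_of_lt_one (by positivity)
    (by have := hb.lam_lt; linarith)
  rw [lt_div_iff₀ hC0] at hh
  set H := 2 * h + 2 with hH
  set ε := β - α
  have hε : 0 < ε := sub_pos.2 hαβ
  have ev : ∀ᶠ R : ℝ in 𝓝[>] 0, (2 / ε + 1) * Real.log (-Real.log R) ≤ Φ R * -Real.log R ∧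
      1 ≤ -Real.log R ∧ (τ ^ H)⁻¹ + 1 ≤ -Real.log R ∧
      R ∈ Set.Ioo 0 (avgLength a (n₀ + 1) / C) ∧ R ∈ Set.Ioo 0 c₁ :=
    (hΦ _).and ((eventually_le_neg_log _).and ((eventually_le_neg_log _).and
      ((eventually_mem_Ioo (div_pos (hb.avg_pos _) hC0)).and (eventually_mem_Ioo hc₁))))
  obtain ⟨δ, hδ, hδev⟩ := mem_nhdsGT_iff_exists_Ioo_subset.1 ev
  refine ⟨δ, hδ, C * 2 ^ H * (c₂ / c) * (1 / -Real.log lam + 1) ^ 2, by positivity, ?_⟩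
  intro R r hR0 hR1 hRδ hr0 hr hRR x hx
  obtain ⟨h1, h2, h3, h4, h5⟩ := hδev ⟨hR0, hRδ⟩
  have hrR : r ≤ R := hr.trans hRR
  have h4' : C * R < avgLength a (n₀ + 1) := by
    have := h4.2; rw [lt_div_iff₀ hC0] at this; linarith
  obtain ⟨n, hn1, hn2⟩ := hb.exists_avg_lt_le (x := C * R) (by positivity)
    (h4'.le.trans (hb.avg_le_one _))
  have hn : n₀ ≤ n := by
    have := hb.strictAnti_avg.lt_iff_gt.1 (hn1.trans h4'); omega
  obtain ⟨N, hN1, hN2⟩ := hb.exists_avg_lt_le (x := r / C) (by positivity)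
    ((div_le_one hC0).2 (by linarith))
  rw [lt_div_iff₀ hC0] at hN1
  rw [div_le_iff₀ hC0] at hN2
  have hnN : n < N + 1 := hb.strictAnti_avg.lt_iff_gt.1 (by nlinarith [hb.avg_pos (N + 1)])
  obtain ⟨m, hm⟩ : ∃ m, N + 1 = n + m := ⟨N + 1 - n, by omega⟩
  -- `log (R / r)` dominates `log |log R|`
  have hRr : 0 < R / r := by positivity
  have hlog : (2 / ε + 1) * Real.log (-Real.log R) ≤ Real.log (R / r) := by
    have := Real.log_le_log hr0 hr
    rw [Real.log_rpow hR0] at this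
    rw [Real.log_div hR0.ne' hr0.ne']
    linarith
  have hll : 0 ≤ Real.log (-Real.log R) := Real.log_nonneg h2
  have hbig : -Real.log R ≤ R / r := by
    rw [← Real.log_le_log_iff (by linarith) hRr]
    have : 0 ≤ 2 / ε * Real.log (-Real.log R) := by positivity
    linarith
  have hpow : (-Real.log R) ^ 2 ≤ (R / r) ^ ε := by
    have e : (-Real.log R) ^ 2 = Real.exp (2 * Real.log (-Real.log R)) := by
      rw [two_mul, Real.exp_add, Real.exp_log (by linarith), sq]
    rw [Real.rpow_def_of_pos hRr, e, Real.exp_le_exp]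
    have : (2 / ε + 1) * Real.log (-Real.log R) * ε ≤ Real.log (R / r) * ε := by gcongr
    have e2 : (2 / ε + 1) * Real.log (-Real.log R) * ε =
        2 * Real.log (-Real.log R) + ε * Real.log (-Real.log R) := by field_simp
    nlinarith
  -- hence `m` is large
  have hmH : H ≤ m := by
    by_contra hlt
    have hlt : m ≤ H := by omega
    have h6 := hb.pow_mul_avg_le n m
    have h7 : τ ^ H ≤ τ ^ m := pow_le_pow_of_le_one hb.tau_pos.le hb.tau_lt_one.le hlt
    have h8 : τ ^ H * R ≤ r := by
      have p := pow_pos hb.tau_pos H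
      rw [hm] at hN1
      calc τ ^ H * R ≤ τ ^ m * (C * R) := by
            have : R ≤ C * R := by nlinarith
            have := pow_pos hb.tau_pos m
            gcongr
        _ ≤ τ ^ m * avgLength a n := by have := pow_pos hb.tau_pos m; gcongr
        _ ≤ avgLength a (n + m) := h6
        _ ≤ avgLength a (n + m) * C := le_mul_of_one_le_right (hb.avg_pos _).le hC
        _ ≤ r := hN1.le
    have p := pow_pos hb.tau_pos H
    have h9 : R / r ≤ (τ ^ H)⁻¹ := by
      rw [div_le_iff₀ hr0, inv_mul_eq_div, le_div_iff₀ p]; linarith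
    linarith
  obtain ⟨k, rfl⟩ := Nat.exists_eq_add_of_le hmH
  have hlow : c * 2 ^ k ≤ c₂ * (R / r) ^ α := by
    obtain ⟨y, hy, hN⟩ := hE (n + 1 + h) k R r
      (by
        have := hb.avg_le_pow_mul (n + 1) h
        have p := pow_pos hb.lam_pos h
        calc _ ≤ lam ^ h * avgLength a (n + 1) := this
          _ ≤ lam ^ h * (C * R) := by gcongr
          _ = lam ^ h * C * R := by ring
          _ ≤ c * R := by gcongr) hr0
      (by
        have := hb.avg_le_pow_mul (n + 1 + h + k) h
        rw [show n + 1 + h + k + h = N by omega] at this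
        have p := hb.avg_pos (n + 1 + h + k)
        calc r ≤ avgLength a N * C := hN2
          _ ≤ lam ^ h * avgLength a (n + 1 + h + k) * C := by gcongr
          _ = lam ^ h * C * avgLength a (n + 1 + h + k) := by ring
          _ ≤ _ := by gcongr)
    have := hN.trans (hα R r hR0 hR1 h5.2 hr0 hr hRR y hy)
    exact (ENNReal.ofReal_le_ofReal_iff (by positivity)).1 this
  refine (hF n hn (H + k) R r hn2 (by rw [← hm]; linarith) x hx).trans
    (ENNReal.ofReal_le_ofReal ?_)
  have hnl : (n : ℝ) + 1 ≤ (1 / -Real.log lam + 1) * -Real.log R := by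
    have h6 := hb.mul_le_neg_log_avg n
    have h7 := Real.log_le_log hR0 (show R ≤ avgLength a n by nlinarith)
    have h8 : (n : ℝ) ≤ 1 / -Real.log lam * -Real.log R := by
      rw [one_div_mul_eq_div, le_div_iff₀ hlam]; linarith
    linarith
  have hk : (2 : ℝ) ^ k ≤ c₂ / c * (R / r) ^ α := by
    rw [div_mul_eq_mul_div, le_div_iff₀ hc]; linarith
  calc C * ((n : ℝ) + 1) ^ 2 * 2 ^ (H + k)
      ≤ C * ((1 / -Real.log lam + 1) * -Real.log R) ^ 2 * 2 ^ (H + k) := by gcongr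
    _ = C * 2 ^ H * (1 / -Real.log lam + 1) ^ 2 * ((-Real.log R) ^ 2 * 2 ^ k) := by ring
    _ ≤ C * 2 ^ H * (1 / -Real.log lam + 1) ^ 2 * ((R / r) ^ ε * (c₂ / c * (R / r) ^ α)) := by
        gcongr
    _ = C * 2 ^ H * (c₂ / c) * (1 / -Real.log lam + 1) ^ 2 * (R / r) ^ β := by
        rw [show β = ε + α by simp [ε], Real.rpow_add hRr]; ring

theorem upperDim_le
    (hΦ : ∀ K : ℝ, ∀ᶠ x in 𝓝[>] 0, K * Real.log (-Real.log x) ≤ Φ x * -Real.log x)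
    (hE : CoverLower a E) (hF : CoverUpper a F) : upperDim Φ F ≤ upperDim Φ E := by
  refine le_iInf₂ fun α hα => ?_
  refine EReal.le_of_forall_lt_iff_le.1 fun β hβ => ?_
  exact iInf₂_le β (hb.upperExponent_of_lt hΦ hE hF hα (EReal.coe_lt_coe_iff.1 hβ))

end LevelBounds

/-! ### Separated points and covering numbers on the line -/

theorem card_le_externalCoveringNumber {ι : Type*} {T : Finset ι} {f : ι → ℝ} {A : Set ℝ} {r : ℝ}
    (hr : 0 ≤ r) (hf : ∀ i ∈ T, f i ∈ A) (hsep : ∀ i ∈ T, ∀ j ∈ T, i ≠ j → 2 * r < |f i - f j|) :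
    (T.card : ℝ≥0∞) ≤ (Metric.externalCoveringNumber r.toNNReal A : ℝ≥0∞) := by
  have hinj : Set.InjOn f T := fun i hi j hj hij => by
    by_contra hne
    have := hsep i hi j hj hne
    rw [hij, sub_self, abs_zero] at this
    linarith
  have h1 : Metric.IsSeparated ((2 * r.toNNReal : ℝ≥0) : ℝ≥0∞) (f '' T) := by
    rintro _ ⟨i, hi, rfl⟩ _ ⟨j, hj, rfl⟩ hne
    have := hsep i hi j hj fun h => hne (by rw [h])
    rw [edist_dist, Real.dist_eq, ENNReal.ofReal, ENNReal.coe_lt_coe, ← Real.toNNReal_ofNat,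
      ← Real.toNNReal_mul (by norm_num)]
    exact (Real.toNNReal_lt_toNNReal_iff (by linarith)).2 this
  have h2 : (f '' T).encard ≤ Metric.externalCoveringNumber r.toNNReal A :=
    (h1.encard_le_packingNumber (by rintro _ ⟨i, hi, rfl⟩; exact hf i hi)).trans
      (Metric.packingNumber_two_mul_le_externalCoveringNumber _ _)
  rw [hinj.encard_image, Set.encard_coe_eq_coe_finsetCard] at h2
  exact_mod_cast (ENat.toENNReal_le.2 h2)

theorem packingNumber_le_of_forall_card_le {A : Set ℝ} {r : ℝ} {B : ℕ}
    (h : ∀ P : Finset ℝ, (P : Set ℝ) ⊆ A →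
      (∀ x ∈ P, ∀ y ∈ P, x ≠ y → r < |x - y|) → P.card ≤ B) :
    Metric.packingNumber r.toNNReal A ≤ B := by
  have key : ∀ P : Finset ℝ, (P : Set ℝ) ⊆ A →
      Metric.IsSeparated (r.toNNReal : ℝ≥0∞) (P : Set ℝ) → P.card ≤ B := by
    intro P hP hs
    refine h P hP fun x hx y hy hne => ?_
    have : (r.toNNReal : ℝ≥0∞) < edist x y := hs hx hy hne
    rw [edist_dist, Real.dist_eq, ENNReal.ofReal, ENNReal.coe_lt_coe] at this
    exact Real.lt_of_toNNReal_lt this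
  refine iSup₂_le fun S hS => iSup_le fun hsep => ?_
  by_contra hlt
  obtain ⟨T, hTS, hT⟩ := Set.exists_subset_encard_eq (s := S) (k := ((B + 1 : ℕ) : ℕ∞)) (by
    rw [not_le] at hlt
    push_cast
    exact Order.add_one_le_of_lt hlt)
  have hfin : T.Finite := Set.finite_of_encard_eq_coe hT
  have h1 := key hfin.toFinset (by simpa using hTS.trans hS)
    (by rw [hfin.coe_toFinset]; exact Set.Pairwise.mono hTS hsep)
  rw [hfin.encard_eq_coe_toFinset_card] at hT
  have : hfin.toFinset.card = B + 1 := by exact_mod_cast hT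
  omega

/-! ### The Cantor set -/

theorem cantorLeft_two_mul (a : ℕ → ℝ) (k j : ℕ) :
    cantorLeft a (k + 1) (2 * j) = cantorLeft a k j := by
  simp [cantorLeft]

theorem cantorLeft_two_mul_add_one (a : ℕ → ℝ) (k j : ℕ) :
    cantorLeft a (k + 1) (2 * j + 1) =
      cantorLeft a k j + (cantorLength a (k + 1) (2 * j) + a (2 ^ k + j)) := by
  have h : (2 * j + 1) / 2 = j := by omega
  simp [cantorLeft, h]

theorem cantorLeft_pow_mul (a : ℕ → ℝ) (k j i : ℕ) :
    cantorLeft a (k + i) (2 ^ i * j) = cantorLeft a k j := by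
  induction i with
  | zero => simp
  | succ i ih => rw [← ih, ← add_assoc, pow_succ', mul_assoc, cantorLeft_two_mul]

section CantorSet

variable {a : ℕ → ℝ} {τ lam : ℝ} (ha : IsLevelComparable a) (hb : LevelBounds a τ lam)

include ha in
theorem level_sum_nonneg (k j i : ℕ) :
    0 ≤ ∑ l ∈ Finset.range (2 ^ i), a (2 ^ (k + i) + 2 ^ i * j + l) :=
  Finset.sum_nonneg fun l _ => ha.nonneg _ (by have := Nat.one_le_two_pow (n := k + i); omega)

include ha in
theorem level_sum_le (k j i : ℕ) :
    ∑ l ∈ Finset.range (2 ^ i), a (2 ^ (k + i) + 2 ^ i * j + l) ≤ 2 ^ i * a (2 ^ (k + i)) := by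
  calc _ ≤ ∑ l ∈ Finset.range (2 ^ i), a (2 ^ (k + i)) := Finset.sum_le_sum fun l _ =>
        ha.antitone_of_le Nat.one_le_two_pow (by omega)
    _ = _ := by simp

include ha in
theorem cantorLength_nonneg (k j : ℕ) : 0 ≤ cantorLength a k j :=
  tsum_nonneg fun i => level_sum_nonneg ha k j i

include ha hb

theorem summable_level_sum (k j : ℕ) :
    Summable fun i => ∑ l ∈ Finset.range (2 ^ i), a (2 ^ (k + i) + 2 ^ i * j + l) :=
  Summable.of_nonneg_of_le (level_sum_nonneg ha k j) (level_sum_le ha k j) (hb.summable_level k)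

theorem cantorLength_le (k j : ℕ) :
    cantorLength a k j ≤ avgLength a k / (τ * (1 - 2 * lam)) :=
  ((summable_level_sum ha hb k j).tsum_le_tsum (level_sum_le ha k j)
    (hb.summable_level k)).trans (hb.tsum_level_le k)

theorem cantorLength_eq (k j : ℕ) : cantorLength a k j =
    a (2 ^ k + j) + (cantorLength a (k + 1) (2 * j) + cantorLength a (k + 1) (2 * j + 1)) := by
  rw [cantorLength, (summable_level_sum ha hb k j).tsum_eq_zero_add, cantorLength, cantorLength,
    ← (summable_level_sum ha hb _ _).tsum_add (summable_level_sum ha hb _ _)]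
  congr 1
  · simp
  · refine tsum_congr fun i => ?_
    rw [pow_succ 2 i, mul_two, Finset.sum_range_add]
    congr 1 <;> refine Finset.sum_congr rfl fun l _ => ?_ <;> congr 1 <;> ring

theorem cantorInterval_succ_subset (k j : ℕ) :
    cantorInterval a (k + 1) j ⊆ cantorInterval a k (j / 2) := by
  have h := cantorLength_eq ha hb k (j / 2)
  have h0 := cantorLength_nonneg ha (k + 1) (2 * (j / 2))
  have h1 := cantorLength_nonneg ha (k + 1) (2 * (j / 2) + 1)
  have h2 := ha.nonneg (2 ^ k + j / 2) (by have := Nat.one_le_two_pow (n := k); omega)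
  rcases Nat.mod_two_eq_zero_or_one j with hj | hj
  · have e : cantorInterval a (k + 1) j = cantorInterval a (k + 1) (2 * (j / 2)) := by
      congr 1; omega
    rw [e, cantorInterval, cantorLeft_two_mul, cantorInterval]
    exact Set.Icc_subset_Icc le_rfl (by linarith)
  · have e : cantorInterval a (k + 1) j = cantorInterval a (k + 1) (2 * (j / 2) + 1) := by
      congr 1; omega
    rw [e, cantorInterval, cantorLeft_two_mul_add_one, cantorInterval]
    exact Set.Icc_subset_Icc (by linarith) (by linarith)

theorem cantorInterval_add_subset (k m j : ℕ) :
    cantorInterval a (k + m) j ⊆ cantorInterval a k (j / 2 ^ m) := by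
  induction m generalizing j with
  | zero => simp
  | succ m ih =>
    refine (cantorInterval_succ_subset ha hb (k + m) j).trans ((ih (j / 2)).trans ?_)
    rw [Nat.div_div_eq_div_mul, pow_succ']

/-- Two Cantor intervals of step `k` are separated by a gap of an earlier step. -/
theorem cantorLeft_add_le {k j j' : ℕ} (hj : j < j') (hj' : j' < 2 ^ k) :
    cantorLeft a k j + cantorLength a k j + a (2 ^ k) ≤ cantorLeft a k j' := by
  induction k generalizing j j' with
  | zero => simp at hj'; omega
  | succ k ih =>
    rw [pow_succ] at hj'
    have hj1 := cantorInterval_succ_subset ha hb k j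
      (Set.right_mem_Icc.2 (le_add_of_nonneg_right (cantorLength_nonneg ha _ _)))
    have hj2 := cantorInterval_succ_subset ha hb k j'
      (Set.left_mem_Icc.2 (le_add_of_nonneg_right (cantorLength_nonneg ha _ _)))
    rcases (Nat.div_le_div_right hj.le : j / 2 ≤ j' / 2).lt_or_eq with h | h
    · have h1 := ih h (by omega)
      have h2 : a (2 ^ (k + 1)) ≤ a (2 ^ k) :=
        ha.antitone_of_le Nat.one_le_two_pow (Nat.pow_le_pow_right two_pos (by omega))
      linarith [hj1.2, hj2.1]
    · obtain ⟨e1, e2⟩ : j = 2 * (j / 2) ∧ j' = 2 * (j / 2) + 1 := by omega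
      rw [e2, cantorLeft_two_mul_add_one]
      have h2 : a (2 ^ (k + 1)) ≤ a (2 ^ k + j / 2) :=
        ha.antitone_of_le (by have := Nat.one_le_two_pow (n := k); omega)
          (by rw [pow_succ]; omega)
      have h3 : cantorLeft a (k + 1) j = cantorLeft a k (j / 2) := by
        conv_lhs => rw [e1]
        exact cantorLeft_two_mul _ _ _
      rw [h3, ← e1]
      linarith

theorem cantorLeft_mem_cantorSet {k j : ℕ} (hj : j < 2 ^ k) : cantorLeft a k j ∈ cantorSet a := by
  simp only [cantorSet, Set.mem_iInter, Set.mem_iUnion]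
  intro i _
  rcases le_total i k with h | h
  · obtain ⟨m, rfl⟩ := Nat.exists_eq_add_of_le h
    refine ⟨j / 2 ^ m, Nat.div_lt_of_lt_mul (by rw [← pow_add, add_comm]; exact hj), ?_⟩
    exact cantorInterval_add_subset ha hb i m j
      (Set.left_mem_Icc.2 (le_add_of_nonneg_right (cantorLength_nonneg ha _ _)))
  · obtain ⟨m, rfl⟩ := Nat.exists_eq_add_of_le h
    refine ⟨2 ^ m * j, ?_, ?_⟩
    · rw [add_comm, pow_add]; gcongr
    · rw [← cantorLeft_pow_mul a k j m]
      exact Set.left_mem_Icc.2 (le_add_of_nonneg_right (cantorLength_nonneg ha _ _))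

theorem coverLower_cantorSet : CoverLower a (cantorSet a) := by
  have hlam := hb.lam_lt
  have hlam0 := hb.lam_pos
  have hτ := hb.tau_pos
  have hτ1 := hb.tau_lt_one
  have h0 : 0 < 1 - 2 * lam := by linarith
  have h1 : 0 < τ * (1 - 2 * lam) := by positivity
  have h1' : τ * (1 - 2 * lam) ≤ 1 - 2 * lam := mul_le_of_le_one_left h0.le hτ1.le
  refine ⟨τ * (1 - 2 * lam) / 3, by positivity, fun n m R r hR hr0 hr => ?_⟩
  refine ⟨0, by simpa [cantorLeft] using cantorLeft_mem_cantorSet ha hb (k := 0) (j := 0) (by simp),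
    ?_⟩
  refine le_trans ?_ (card_le_externalCoveringNumber (T := Finset.range (2 ^ m))
    (f := cantorLeft a (n + m)) hr0.le ?_ ?_)
  · rw [Finset.card_range, ← ENNReal.ofReal_natCast]
    refine ENNReal.ofReal_le_ofReal ?_
    push_cast
    exact mul_le_of_le_one_left (by positivity) (by linarith)
  · intro j hj
    rw [Finset.mem_range] at hj
    refine ⟨?_, cantorLeft_mem_cantorSet ha hb
      (hj.trans_le (Nat.pow_le_pow_right two_pos (by omega)))⟩
    have h2 := cantorInterval_add_subset ha hb n m j
      (Set.left_mem_Icc.2 (le_add_of_nonneg_right (cantorLength_nonneg ha _ _)))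
    rw [Nat.div_eq_of_lt hj] at h2
    have h3 : cantorLeft a n 0 = 0 := by
      simpa [cantorLeft] using cantorLeft_pow_mul a 0 0 n
    have h4 := cantorLength_le ha hb n 0
    rw [le_div_iff₀ h1] at h4
    rw [cantorInterval, h3, zero_add] at h2
    rw [Metric.mem_closedBall, Real.dist_eq, sub_zero, abs_of_nonneg h2.1]
    refine h2.2.trans (le_of_mul_le_mul_right ?_ h1)
    nlinarith [hb.avg_pos n]
  · have key : ∀ i j, i < j → j < 2 ^ m →
        2 * r < |cantorLeft a (n + m) i - cantorLeft a (n + m) j| := by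
      intro i j hij hj
      have h2 := cantorLeft_add_le ha hb (k := n + m) hij
        (hj.trans_le (Nat.pow_le_pow_right two_pos (by omega)))
      have h3 := hb.mul_avg_le (n + m)
      have h4 := hb.avg_pos (n + m)
      have h5 := cantorLength_nonneg ha (n + m) i
      rw [abs_sub_comm]
      refine lt_of_lt_of_le ?_ (le_abs_self _)
      nlinarith
    intro i hi j hj hne
    rw [Finset.mem_range] at hi hj
    rcases lt_or_gt_of_ne hne with h | h
    · exact key i j h hj
    · rw [abs_sub_comm]; exact key j i h hi

theorem coverUpper_cantorSet : CoverUpper a (cantorSet a) := by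
  have hlam := hb.lam_lt
  have hlam0 := hb.lam_pos
  have hτ := hb.tau_pos
  have h0 : 0 < 1 - 2 * lam := by linarith
  have h1 : 0 < τ * (1 - 2 * lam) := by positivity
  -- `A * R ≤ s_n` forces `3 * R ≤ a (2 ^ n)`
  set A := 3 / (1 - 2 * lam) with hA
  set B := 1 / (τ * (1 - 2 * lam)) with hB
  have hB0 : 0 < B := by positivity
  have hA3 : 3 ≤ A := by rw [hA, le_div_iff₀ h0]; nlinarith
  refine ⟨A + B, by linarith, 1, fun n hn m R r hR hr x hx => ?_⟩
  have hRa : R < a (2 ^ n) := by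
    rcases le_or_gt R 0 with h | h
    · exact h.trans_lt (hb.pos n)
    · have h2 := hb.mul_avg_le n
      have h3 : A * R ≤ avgLength a n := by nlinarith
      have h4 : (1 - 2 * lam) * (A * R) = 3 * R := by rw [hA]; field_simp
      nlinarith
  have hx' := hx
  simp only [cantorSet, Set.mem_iInter, Set.mem_iUnion] at hx
  obtain ⟨j, hj, hxj⟩ := hx n hn
  have hcover : Metric.IsCover r.toNNReal (Metric.closedBall x R ∩ cantorSet a)
      ((fun l => cantorLeft a (n + m) (2 ^ m * j + l)) '' (Finset.range (2 ^ m))) := by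
    rintro y ⟨hyx, hy⟩
    simp only [cantorSet, Set.mem_iInter, Set.mem_iUnion] at hy
    obtain ⟨i, hi, hyi⟩ := hy (n + m) (by omega)
    have hy2 := cantorInterval_add_subset ha hb n m i hyi
    have hin : i / 2 ^ m < 2 ^ n := Nat.div_lt_of_lt_mul (by rwa [← pow_add, add_comm])
    rw [Metric.mem_closedBall, Real.dist_eq] at hyx
    have hij : i / 2 ^ m = j := by
      rcases lt_trichotomy (i / 2 ^ m) j with h | h | h
      · have := cantorLeft_add_le ha hb h hj
        have := neg_le_abs (y - x)
        linarith [hxj.1, hy2.2]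
      · exact h
      · have := cantorLeft_add_le ha hb h hin
        have := le_abs_self (y - x)
        linarith [hxj.2, hy2.1]
    refine ⟨cantorLeft a (n + m) (2 ^ m * j + i % 2 ^ m),
      ⟨i % 2 ^ m, by simpa using Nat.mod_lt _ (by positivity), rfl⟩, ?_⟩
    have e : 2 ^ m * j + i % 2 ^ m = i := by rw [← hij]; exact Nat.div_add_mod _ _
    rw [e]
    have h5 := cantorLength_le ha hb (n + m) i
    have h6 : avgLength a (n + m) / (τ * (1 - 2 * lam)) ≤ r := by
      refine le_trans ?_ hr
      rw [div_eq_inv_mul, ← one_div]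
      have := hb.avg_pos (n + m)
      gcongr
      linarith
    change edist y _ ≤ _
    rw [edist_dist, Real.dist_eq, ENNReal.ofReal, ENNReal.coe_le_coe]
    refine Real.toNNReal_le_toNNReal ?_
    rw [abs_of_nonneg (by linarith [hyi.1])]
    linarith [hyi.2]
  have hcard := hcover.externalCoveringNumber_le_encard.trans (Set.encard_image_le _ _)
  rw [Set.encard_coe_eq_coe_finsetCard, Finset.card_range] at hcard
  refine (ENat.toENNReal_le.2 hcard).trans ?_
  rw [ENat.toENNReal_coe, ← ENNReal.ofReal_natCast]
  refine ENNReal.ofReal_le_ofReal ?_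
  push_cast
  have h7 : (1 : ℝ) ≤ (n + 1) ^ 2 := one_le_pow₀ (by linarith [(Nat.cast_nonneg n : (0 : ℝ) ≤ n)])
  refine le_mul_of_one_le_left (by positivity) ?_
  nlinarith

end CantorSet

/-! ### Rearrangements -/

/-- The numbers of the gaps of step `k`. -/
def levelGaps (k : ℕ) : Finset ℕ+ := Finset.Ico (2 ^ k) (2 ^ (k + 1))

theorem mem_levelGaps {k : ℕ} {i : ℕ+} :
    i ∈ levelGaps k ↔ 2 ^ k ≤ (i : ℕ) ∧ (i : ℕ) < 2 ^ (k + 1) := by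
  rw [levelGaps, Finset.mem_Ico, ← PNat.coe_le_coe, ← PNat.coe_lt_coe]
  simp

theorem card_levelGaps (k : ℕ) : (levelGaps k).card = 2 ^ k := by
  rw [levelGaps, PNat.card_Ico, PNat.pow_coe, PNat.pow_coe, pow_succ, PNat.val_ofNat]
  omega

theorem exists_mem_levelGaps (i : ℕ+) : ∃ k, i ∈ levelGaps k :=
  ⟨Nat.log 2 i, mem_levelGaps.2 ⟨Nat.pow_log_le_self 2 i.ne_zero,
    Nat.lt_pow_succ_log_self one_lt_two _⟩⟩

theorem not_lt_and_lt (o : OrderSpace) {i j : ℕ+} (h : o.1 i j) : ¬ o.1 j i := fun h' =>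
  o.2.irrefl i (o.2.trans _ _ _ h h')

theorem rel_trichotomous (o : OrderSpace) (i j : ℕ+) : o.1 i j ∨ i = j ∨ o.1 j i := by
  by_contra! h
  exact h.2.1 (o.2.trichotomous i j h.1 h.2.2)

section Rearrangement

variable {a : ℕ → ℝ} (ha : IsLevelComparable a) (o : OrderSpace)
include ha

theorem apply_nonneg (i : ℕ+) : 0 ≤ a i := ha.nonneg i i.pos

theorem tsum_subtype_add_le {S T : Set ℕ+} {i : ℕ+} (hST : S ⊆ T) (hiT : i ∈ T) (hiS : i ∉ S) :
    (∑' j : S, a (j : ℕ+)) + a i ≤ ∑' j : T, a (j : ℕ+) := by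
  have hs := ha.hasSum.summable
  rw [tsum_subtype S (fun j : ℕ+ => a j), tsum_subtype T (fun j : ℕ+ => a j)]
  have h1 : a i = ∑' j, ({i} : Set ℕ+).indicator (fun j : ℕ+ => a j) j := by
    rw [← tsum_subtype]; simp
  rw [h1, ← (hs.indicator S).tsum_add (hs.indicator {i})]
  refine ((hs.indicator S).add (hs.indicator {i})).tsum_le_tsum (fun j => ?_) (hs.indicator T)
  have hj := apply_nonneg ha j
  by_cases hji : j = i
  · subst hji; simp [hiS, hiT]
  · by_cases hjS : j ∈ S
    · simp [hji, hjS, hST hjS]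
    · simp only [Set.indicator_of_notMem hjS, Set.mem_singleton_iff, hji, not_false_eq_true,
        Set.indicator_of_notMem, add_zero]
      exact Set.indicator_nonneg (fun _ _ => apply_nonneg ha _) j

theorem gapLeft_nonneg (i : ℕ+) : 0 ≤ gapLeft a o i :=
  tsum_nonneg fun _ => apply_nonneg ha _

theorem gapLeft_add_le_one (i : ℕ+) : gapLeft a o i + a i ≤ 1 := by
  have := tsum_subtype_add_le ha (S := {j | o.1 j i}) (T := Set.univ) (i := i)
    (Set.subset_univ _) (Set.mem_univ _) (o.2.irrefl i)
  rw [tsum_univ (fun j : ℕ+ => a j), ha.hasSum.tsum_eq] at this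
  exact this

theorem gapLeft_add_le {i j : ℕ+} (h : o.1 i j) : gapLeft a o i + a i ≤ gapLeft a o j :=
  tsum_subtype_add_le ha (S := {l | o.1 l i}) (T := {l | o.1 l j}) (i := i)
    (fun _ hl => o.2.trans _ _ _ hl h) h (o.2.irrefl i)

theorem gapLeft_mem_rearrangement (i : ℕ+) : gapLeft a o i ∈ rearrangement a o := by
  rw [rearrangement, ha.hasSum.tsum_eq]
  have hi := apply_nonneg ha i
  refine ⟨⟨gapLeft_nonneg ha o i, by linarith [gapLeft_add_le_one ha o i]⟩, ?_⟩
  simp only [Set.mem_iUnion, not_exists]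
  rintro j ⟨h1, h2⟩
  rcases rel_trichotomous o i j with h | rfl | h
  · linarith [gapLeft_add_le ha o h]
  · linarith
  · linarith [gapLeft_add_le ha o h]

theorem volume_rearrangement : volume (rearrangement a o) = 0 := by
  have hdisj : Pairwise (Function.onFun Disjoint
      fun i : ℕ+ => Set.Ioo (gapLeft a o i) (a i + gapLeft a o i)) := by
    intro i j hij
    refine Set.disjoint_left.2 fun x hx hy => ?_
    rcases rel_trichotomous o i j with h | h | h
    · linarith [gapLeft_add_le ha o h, hx.2, hy.1]
    · exact hij h
    · linarith [gapLeft_add_le ha o h, hx.1, hy.2]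
  have hvol : volume (⋃ i : ℕ+, Set.Ioo (gapLeft a o i) (a i + gapLeft a o i)) = 1 := by
    rw [measure_iUnion hdisj fun _ => measurableSet_Ioo]
    simp only [Real.volume_Ioo, add_sub_cancel_right]
    rw [← ENNReal.ofReal_tsum_of_nonneg (fun i => apply_nonneg ha i) ha.hasSum.summable,
      ha.hasSum.tsum_eq, ENNReal.ofReal_one]
  rw [rearrangement, ha.hasSum.tsum_eq, measure_sdiff _
    (MeasurableSet.iUnion fun _ => measurableSet_Ioo).nullMeasurableSet (by rw [hvol]; simp), hvol]
  · simp
  · refine Set.iUnion_subset fun i => fun x hx => ⟨?_, ?_⟩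
    · linarith [gapLeft_nonneg ha o i, hx.1]
    · linarith [gapLeft_add_le_one ha o i, hx.2]

/-- The number of points of an `r`-separated subset `P` of a rearrangement is controlled by the
gaps between its points: the intervals `(p, p + r)`, `p ∈ P`, have total length `r |P|`, are
filled by gaps up to a null set, and meet any given gap in a set of measure at most `r`. -/
theorem card_mul_le_tsum {P : Finset ℝ} (hP : (P : Set ℝ) ⊆ rearrangement a o) {r : ℝ}
    (hr : 0 < r) (hsep : ∀ x ∈ P, ∀ y ∈ P, x ≠ y → r < |x - y|) {c : ℕ → ℝ}
    (hc : ∀ k, ∀ T ⊆ levelGaps k,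
      (∀ i ∈ T, ∃ x ∈ P, ∃ y ∈ P, x ≤ gapLeft a o i ∧ a i + gapLeft a o i ≤ y) →
      (T.card : ℝ) ≤ c k)
    (hsum : Summable fun k => c k * min (a (2 ^ k)) r) :
    ((P.card : ℝ) - 1) * r ≤ ∑' k, c k * min (a (2 ^ k)) r := by
  classical
  have hc0 : ∀ k, 0 ≤ c k := fun k => by simpa using hc k ∅ (by simp) (by simp)
  have hmin0 : ∀ k, 0 ≤ min (a (2 ^ k)) r := fun k =>
    le_min (ha.nonneg _ Nat.one_le_two_pow) hr.le
  have hterm0 : ∀ k, 0 ≤ c k * min (a (2 ^ k)) r := fun k => mul_nonneg (hc0 k) (hmin0 k)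
  rcases P.eq_empty_or_nonempty with rfl | hne
  · have : 0 ≤ ∑' k, c k * min (a (2 ^ k)) r := tsum_nonneg hterm0
    simp only [Finset.card_empty, Nat.cast_zero, zero_sub, neg_mul, one_mul]
    linarith
  set w := P.max' hne with hw
  have hwP : w ∈ P := P.max'_mem hne
  have hPw : ∀ p ∈ P.erase w, p + r < w := fun p hp => by
    have h1 := hsep w hwP p (Finset.mem_of_mem_erase hp) (Finset.ne_of_mem_erase hp).symm
    rwa [abs_of_nonneg (sub_nonneg.2 (P.le_max' p (Finset.mem_of_mem_erase hp))),
      lt_sub_iff_add_lt, add_comm] at h1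
  set U : Set ℝ := ⋃ p ∈ P.erase w, Set.Ioo p (p + r) with hU
  have hUvol : volume U = ENNReal.ofReal (((P.card : ℝ) - 1) * r) := by
    rw [hU, measure_biUnion_finset _ fun _ _ => measurableSet_Ioo]
    · simp only [Real.volume_Ioo, add_sub_cancel_left, Finset.sum_const]
      rw [nsmul_eq_mul, ← Finset.cast_card_erase_of_mem hwP, ENNReal.ofReal_mul' hr.le,
        ENNReal.ofReal_natCast]
    · intro p hp q hq hpq
      refine Set.disjoint_left.2 fun x hx hy => ?_
      have h1 := hsep p (Finset.mem_of_mem_erase hp) q (Finset.mem_of_mem_erase hq) hpq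
      rcases lt_abs.1 h1 with h | h <;> linarith [hx.1, hx.2, hy.1, hy.2]
  have hnotin : ∀ p ∈ P, ∀ i : ℕ+, p ≤ gapLeft a o i ∨ a i + gapLeft a o i ≤ p := fun p hp i => by
    by_contra! h
    exact (hP hp).2 (Set.mem_iUnion.2 ⟨i, h⟩)
  have hUJ : ∀ i : ℕ+, ∀ t ∈ U ∩ Set.Ioo (gapLeft a o i) (a i + gapLeft a o i),
      ∃ p ∈ P.erase w, t ∈ Set.Ioo p (p + r) ∧ p ≤ gapLeft a o i ∧ a i + gapLeft a o i ≤ w := by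
    rintro i t ⟨htU, htJ⟩
    simp only [hU, Set.mem_iUnion] at htU
    obtain ⟨p, hp, ht⟩ := htU
    refine ⟨p, hp, ht, (hnotin p (Finset.mem_of_mem_erase hp) i).resolve_right ?_,
      (hnotin w hwP i).resolve_left ?_⟩
    · linarith [ht.1, htJ.2]
    · linarith [ht.2, htJ.1, hPw p hp]
  have hlevel : ∀ k, ∑ i ∈ levelGaps k,
      volume (U ∩ Set.Ioo (gapLeft a o i) (a i + gapLeft a o i)) ≤
        ENNReal.ofReal (c k * min (a (2 ^ k)) r) := by
    intro k
    set T := (levelGaps k).filter fun i =>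
      ∃ x ∈ P, ∃ y ∈ P, x ≤ gapLeft a o i ∧ a i + gapLeft a o i ≤ y
    have hT := hc k T (Finset.filter_subset _ _) fun i hi => (Finset.mem_filter.1 hi).2
    have h1 : ∑ i ∈ levelGaps k, volume (U ∩ Set.Ioo (gapLeft a o i) (a i + gapLeft a o i)) =
        ∑ i ∈ T, volume (U ∩ Set.Ioo (gapLeft a o i) (a i + gapLeft a o i)) := by
      refine (Finset.sum_subset (Finset.filter_subset _ _) fun i hi hiT => ?_).symm
      have : U ∩ Set.Ioo (gapLeft a o i) (a i + gapLeft a o i) = ∅ := by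
        refine Set.eq_empty_of_forall_notMem fun t ht => ?_
        obtain ⟨p, hp, -, h2, h3⟩ := hUJ i t ht
        exact hiT (Finset.mem_filter.2 ⟨hi, p, Finset.mem_of_mem_erase hp, w, hwP, h2, h3⟩)
      rw [this, measure_empty]
    have h2 : ∀ i ∈ T, volume (U ∩ Set.Ioo (gapLeft a o i) (a i + gapLeft a o i)) ≤
        ENNReal.ofReal (min (a (2 ^ k)) r) := by
      intro i hi
      rw [ENNReal.ofReal_min]
      refine le_min ?_ ?_
      · refine (measure_mono Set.inter_subset_right).trans ?_
        rw [Real.volume_Ioo, add_sub_cancel_right]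
        exact ENNReal.ofReal_le_ofReal (ha.antitone_of_le Nat.one_le_two_pow
          (mem_levelGaps.1 (Finset.mem_filter.1 hi).1).1)
      · rcases (U ∩ Set.Ioo (gapLeft a o i) (a i + gapLeft a o i)).eq_empty_or_nonempty
          with h | ⟨t, ht⟩
        · rw [h, measure_empty]; exact zero_le
        obtain ⟨p, hp, htp, hpl, -⟩ := hUJ i t ht
        have hsub : U ∩ Set.Ioo (gapLeft a o i) (a i + gapLeft a o i) ⊆ Set.Ioo p (p + r) := by
          intro t' ht'
          obtain ⟨q, hq, htq, hql, -⟩ := hUJ i t' ht'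
          -- both `p` and `q` lie within `r` to the left of the gap
          by_cases hpq : p = q
          · rwa [hpq]
          have h1 := hsep p (Finset.mem_of_mem_erase hp) q (Finset.mem_of_mem_erase hq) hpq
          rcases lt_abs.1 h1 with h | h <;> linarith [ht.2.1, ht'.2.1, htp.2, htq.2]
        refine (measure_mono hsub).trans ?_
        rw [Real.volume_Ioo, add_sub_cancel_left]
    rw [h1]
    refine (Finset.sum_le_card_nsmul _ _ _ h2).trans ?_
    rw [nsmul_eq_mul, ← ENNReal.ofReal_natCast, ← ENNReal.ofReal_mul (Nat.cast_nonneg _)]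
    exact ENNReal.ofReal_le_ofReal (mul_le_mul_of_nonneg_right hT (hmin0 k))
  have hcov : U ⊆ rearrangement a o ∪ ⋃ k, ⋃ i ∈ levelGaps k,
      (U ∩ Set.Ioo (gapLeft a o i) (a i + gapLeft a o i)) := by
    intro t ht
    by_cases htK : t ∈ rearrangement a o
    · exact Or.inl htK
    right
    have ht01 : t ∈ Set.Icc 0 (∑' i : ℕ+, a i) := by
      have ht' := ht
      simp only [hU, Set.mem_iUnion] at ht'
      obtain ⟨p, hp, htp⟩ := ht'
      have h1 := (hP (Finset.mem_of_mem_erase hp)).1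
      have h2 := (hP hwP).1
      exact ⟨h1.1.trans htp.1.le, by linarith [htp.2, hPw p hp, h2.2]⟩
    have : t ∈ ⋃ i : ℕ+, Set.Ioo (gapLeft a o i) (a i + gapLeft a o i) := by
      by_contra h
      exact htK ⟨ht01, h⟩
    obtain ⟨i, hi⟩ := Set.mem_iUnion.1 this
    obtain ⟨k, hk⟩ := exists_mem_levelGaps i
    exact Set.mem_iUnion.2 ⟨k, Set.mem_iUnion₂.2 ⟨i, hk, ht, hi⟩⟩
  have hfinal : ENNReal.ofReal (((P.card : ℝ) - 1) * r) ≤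
      ENNReal.ofReal (∑' k, c k * min (a (2 ^ k)) r) := by
    rw [← hUvol, ENNReal.ofReal_tsum_of_nonneg hterm0 hsum]
    refine (measure_mono hcov).trans ((measure_union_le _ _).trans ?_)
    rw [volume_rearrangement ha o, zero_add]
    refine (measure_iUnion_le _).trans (ENNReal.tsum_le_tsum fun k => ?_)
    exact (measure_biUnion_finset_le _ _).trans (hlevel k)
  exact (ENNReal.ofReal_le_ofReal_iff (tsum_nonneg hterm0)).1 hfinal

variable {τ lam : ℝ} (hb : LevelBounds a τ lam)
include hb

/-- If at most `B * 2 ^ k` gaps of step `k` lie between points of `P`, for every `k`, then `P` has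
about `B * 2 ^ N` points at most, where `s_N` is about `r`. -/
theorem card_le_of_forall_card_le {P : Finset ℝ} (hP : (P : Set ℝ) ⊆ rearrangement a o) {r : ℝ}
    {N : ℕ} (hr : avgLength a N ≤ r) (hsep : ∀ x ∈ P, ∀ y ∈ P, x ≠ y → r < |x - y|) {B : ℝ}
    (hB : 0 ≤ B)
    (hc : ∀ k, ∀ T ⊆ levelGaps k,
      (∀ i ∈ T, ∃ x ∈ P, ∃ y ∈ P, x ≤ gapLeft a o i ∧ a i + gapLeft a o i ≤ y) →
      (T.card : ℝ) ≤ B * 2 ^ k) :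
    (P.card : ℝ) ≤ 1 + B * 2 ^ N * (1 + 1 / (τ * (1 - 2 * lam))) := by
  have hr0 : 0 < r := (hb.avg_pos N).trans_le hr
  have hD : 0 < τ * (1 - 2 * lam) :=
    mul_pos hb.tau_pos (by have := hb.lam_lt; linarith)
  have hs0 : Summable fun k => 2 ^ k * a (2 ^ k) := by simpa using hb.summable_level 0
  have hs1 : Summable fun k => 2 ^ k * min (a (2 ^ k)) r :=
    Summable.of_nonneg_of_le (fun k => mul_nonneg (by positivity) (le_min (hb.pos k).le hr0.le))
      (fun k => by gcongr; exact min_le_left _ _) hs0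
  have h1 := card_mul_le_tsum ha o hP hr0 hsep hc
    ((hs1.mul_left B).congr fun k => by ring)
  have h2 : ∑' k, 2 ^ k * min (a (2 ^ k)) r ≤ 2 ^ N * r * (1 + 1 / (τ * (1 - 2 * lam))) := by
    rw [← hs1.sum_add_tsum_nat_add N, mul_add, mul_one]
    refine add_le_add ?_ ?_
    · calc _ ≤ ∑ k ∈ Finset.range N, 2 ^ k * r :=
            Finset.sum_le_sum fun k _ => by gcongr; exact min_le_right _ _
        _ ≤ 2 ^ N * r := by
            rw [← Finset.sum_mul, geom_sum_eq (by norm_num)]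
            have : (0 : ℝ) < 2 ^ N := by positivity
            nlinarith
    · calc _ ≤ ∑' k, 2 ^ N * (2 ^ k * a (2 ^ (N + k))) := by
            refine Summable.tsum_le_tsum (fun k => ?_) ((summable_nat_add_iff N).2 hs1)
              ((hb.summable_level N).mul_left _)
            rw [← mul_assoc, ← pow_add, add_comm k N]
            gcongr
            exact min_le_left _ _
        _ = 2 ^ N * ∑' k, 2 ^ k * a (2 ^ (N + k)) := tsum_mul_left
        _ ≤ 2 ^ N * (avgLength a N / (τ * (1 - 2 * lam))) := by
            gcongr; exact hb.tsum_level_le N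
        _ ≤ 2 ^ N * (r / (τ * (1 - 2 * lam))) := by gcongr
        _ = _ := by ring
  have h3 : ∑' k, B * 2 ^ k * min (a (2 ^ k)) r = B * ∑' k, 2 ^ k * min (a (2 ^ k)) r := by
    rw [← tsum_mul_left]; exact tsum_congr fun k => by ring
  rw [h3] at h1
  have h4 : ((P.card : ℝ) - 1) * r ≤ B * 2 ^ N * (1 + 1 / (τ * (1 - 2 * lam))) * r := by
    calc _ ≤ B * (2 ^ N * r * (1 + 1 / (τ * (1 - 2 * lam)))) := h1.trans (by gcongr)
      _ = _ := by ring
  linarith [le_of_mul_le_mul_right h4 hr0]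

/-- A lower bound that holds for every order: the set is covered by about `2 ^ n` balls of radius
`s_n`, so one of them contains the left end points of about `2 ^ m` gaps of step `n + m`. -/
theorem coverLower_rearrangement : CoverLower a (rearrangement a o) := by
  classical
  have hlam := hb.lam_lt
  have hlam0 := hb.lam_pos
  have hτ := hb.tau_pos
  have hτ1 := hb.tau_lt_one
  have h0 : 0 < 1 - 2 * lam := by linarith
  have h1 : 0 < τ * (1 - 2 * lam) := by positivity
  set D := 1 / (τ * (1 - 2 * lam)) with hD
  have hD0 : 0 < D := by positivity
  set c := min (1 / (2 + D)) (τ * (1 - 2 * lam) / 3) with hcdef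
  have hc0 : 0 < c := lt_min (by positivity) (by positivity)
  have hc1 : c ≤ 1 := (min_le_left _ _).trans (by rw [div_le_one (by positivity)]; linarith)
  refine ⟨c, hc0, fun n m R r hR hr0 hr => ?_⟩
  have hs := hb.avg_pos n
  have hR' : avgLength a n ≤ R := by nlinarith
  set B : ℕ := ⌊2 ^ n * (2 + D)⌋₊ with hBdef
  have hpack : Metric.packingNumber (avgLength a n).toNNReal (rearrangement a o) ≤ B := by
    refine packingNumber_le_of_forall_card_le fun P hP hsep => Nat.le_floor ?_
    have h2 := card_le_of_forall_card_le ha o hb hP le_rfl hsep zero_le_one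
      (fun k T hT _ => by
        rw [one_mul]
        exact_mod_cast (Finset.card_le_card hT).trans (card_levelGaps k).le)
    have h3 : (1 : ℝ) ≤ 2 ^ n := one_le_pow₀ (by norm_num)
    nlinarith
  have hcovtop : Metric.coveringNumber (avgLength a n).toNNReal (rearrangement a o) ≠ ⊤ :=
    ne_top_of_le_ne_top (ENat.natCast_ne_top B)
      ((Metric.coveringNumber_le_packingNumber _ _).trans hpack)
  set C := Metric.finite_minimalCover (ε := (avgLength a n).toNNReal)
    (A := rearrangement a o) |>.toFinset with hC
  have hCmem : ∀ y, y ∈ C ↔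
      y ∈ Metric.minimalCover (avgLength a n).toNNReal (rearrangement a o) := by simp [hC]
  have hCcard : C.card ≤ B := by
    have h2 := (Metric.encard_minimalCover hcovtop).le.trans
      ((Metric.coveringNumber_le_packingNumber _ _).trans hpack)
    rw [Metric.finite_minimalCover.encard_eq_coe_toFinset_card] at h2
    exact_mod_cast h2
  have hcov := Metric.isCover_minimalCover hcovtop
  have hex : ∀ i : ℕ+, ∃ y ∈ C, |gapLeft a o i - y| ≤ avgLength a n := fun i => by
    obtain ⟨y, hy, h2⟩ := hcov (gapLeft_mem_rearrangement ha o i)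
    refine ⟨y, (hCmem y).2 hy, ?_⟩
    change edist _ _ ≤ _ at h2
    rw [edist_dist, Real.dist_eq, ENNReal.ofReal, ENNReal.coe_le_coe,
      Real.toNNReal_le_toNNReal_iff hs.le] at h2
    exact h2
  choose f hfC hf using hex
  have hb' : C.card • ((2 : ℝ) ^ m / (2 + D)) ≤ ((levelGaps (n + m)).card : ℝ) := by
    rw [card_levelGaps, nsmul_eq_mul]
    have h2 : (C.card : ℝ) ≤ 2 ^ n * (2 + D) :=
      (Nat.cast_le.2 hCcard).trans (Nat.floor_le (by positivity))
    calc _ ≤ 2 ^ n * (2 + D) * ((2 : ℝ) ^ m / (2 + D)) := by gcongr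
      _ = _ := by push_cast; rw [pow_add]; field_simp
  obtain ⟨y, hy, hcard⟩ := Finset.exists_le_card_fiber_of_nsmul_le_card_of_maps_to
    (s := levelGaps (n + m)) (fun i _ => hfC i) ⟨f 1, hfC 1⟩ hb'
  refine ⟨y, Metric.minimalCover_subset ((hCmem y).1 hy), ?_⟩
  refine le_trans ?_ (card_le_externalCoveringNumber (f := gapLeft a o)
    (T := (levelGaps (n + m)).filter fun i => f i = y) hr0.le ?_ ?_)
  · rw [← ENNReal.ofReal_natCast]
    refine ENNReal.ofReal_le_ofReal (le_trans ?_ hcard)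
    rw [div_eq_inv_mul, ← one_div]
    gcongr
    exact min_le_left _ _
  · intro i hi
    refine ⟨?_, gapLeft_mem_rearrangement ha o i⟩
    rw [Metric.mem_closedBall, Real.dist_eq, ← (Finset.mem_filter.1 hi).2]
    exact (hf i).trans hR'
  · have hgap : ∀ i ∈ levelGaps (n + m), 2 * r < a i := fun i hi => by
      have h2 : a (2 ^ (n + m + 1)) ≤ a i :=
        ha.antitone_of_le i.pos (mem_levelGaps.1 hi).2.le
      have h3 := hb.mul_avg_le (n + m + 1)
      have h4 := hb.le_avg_succ (n + m)
      have h5 := hb.avg_pos (n + m)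
      have h6 : c ≤ τ * (1 - 2 * lam) / 3 := min_le_right _ _
      have h7 : r ≤ τ * (1 - 2 * lam) / 3 * avgLength a (n + m) := hr.trans (by gcongr)
      have h8 : (1 - 2 * lam) * (τ * avgLength a (n + m)) ≤
          (1 - 2 * lam) * avgLength a (n + m + 1) := by gcongr
      linarith
    intro i hi j hj hij
    rcases rel_trichotomous o i j with h | h | h
    · have := gapLeft_add_le ha o h
      have := hgap i (Finset.mem_filter.1 hi).1
      rw [abs_sub_comm]
      exact lt_of_lt_of_le (by linarith) (le_abs_self _)
    · exact absurd h hij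
    · have := gapLeft_add_le ha o h
      have := hgap j (Finset.mem_filter.1 hj).1
      exact lt_of_lt_of_le (by linarith) (le_abs_self _)

omit ha hb in
/-- For large `n`, the gaps of step `k ≥ n` are spread evenly, up to the factor `n ^ 2`, over the
`2 ^ n` stretches into which the gaps of the steps before `n` divide the order. -/
def BalancedOrder (o : OrderSpace) : Prop :=
  ∃ n₀ : ℕ, ∀ n ≥ n₀, ∀ k ≥ n, ∀ T ⊆ levelGaps k,
    (∀ i ∈ T, ∀ j ∈ T, ∀ l : ℕ+, (l : ℕ) < 2 ^ n → ¬ (o.1 i l ∧ o.1 l j)) →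
      (T.card : ℝ) ≤ 32 * (n + 1) ^ 2 * 2 ^ (k - n)

variable {o}

/-- A ball that is shorter than the gaps of the steps before `n` meets only one of the stretches
between them. -/
theorem coverUpper_rearrangement (ho : BalancedOrder o) : CoverUpper a (rearrangement a o) := by
  obtain ⟨n₀, ho⟩ := ho
  have hlam := hb.lam_lt
  have hlam0 := hb.lam_pos
  have hτ := hb.tau_pos
  have h0 : 0 < 1 - 2 * lam := by linarith
  have h1 : 0 < τ * (1 - 2 * lam) := by positivity
  set D := 1 / (τ * (1 - 2 * lam)) with hD
  have hD0 : 0 < D := by positivity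
  -- `A * R ≤ s_n` forces `3 * R ≤ a (2 ^ n)`
  set A := 3 / (1 - 2 * lam) with hA
  have hA3 : 3 ≤ A := by rw [hA, le_div_iff₀ h0]; nlinarith
  refine ⟨A + 33 + 32 * D, by linarith, n₀, fun n hn m R r hR hr x hx => ?_⟩
  have hRa : 2 * R < a (2 ^ n) := by
    rcases le_or_gt R 0 with h | h
    · have := hb.pos n
      linarith
    · have h2 := hb.mul_avg_le n
      have h3 : A * R ≤ avgLength a n := by nlinarith
      have h4 : (1 - 2 * lam) * (A * R) = 3 * R := by rw [hA]; field_simp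
      nlinarith
  have hr' : avgLength a (n + m) ≤ r := by
    have := hb.avg_pos (n + m); nlinarith
  have hn1 : (1 : ℝ) ≤ (n + 1) ^ 2 * 2 ^ m := one_le_mul_of_one_le_of_one_le
    (one_le_pow₀ (by linarith [(Nat.cast_nonneg n : (0 : ℝ) ≤ n)])) (one_le_pow₀ (by norm_num))
  have hpack : Metric.packingNumber r.toNNReal (Metric.closedBall x R ∩ rearrangement a o) ≤
      (⌊(A + 33 + 32 * D) * (n + 1) ^ 2 * 2 ^ m⌋₊ : ℕ) := by
    refine packingNumber_le_of_forall_card_le fun P hP hsep => Nat.le_floor ?_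
    have hball : ∀ p ∈ P, ∀ q ∈ P, q - p ≤ 2 * R := fun p hp q hq => by
      have h2 := (hP hp).1
      have h3 := (hP hq).1
      rw [Metric.mem_closedBall, Real.dist_eq, abs_le] at h2 h3
      linarith
    have hlong : ∀ l : ℕ+, (l : ℕ) < 2 ^ n → 2 * R < a l := fun l hl =>
      hRa.trans_le (ha.antitone_of_le l.pos hl.le)
    have h2 := card_le_of_forall_card_le ha o hb (hP.trans Set.inter_subset_right) hr' hsep
      (B := 32 * (n + 1) ^ 2 / 2 ^ n) (by positivity) (fun k T hT hTP => by
        rcases lt_or_ge k n with hkn | hkn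
        · rw [Finset.eq_empty_of_forall_notMem (s := T), Finset.card_empty, Nat.cast_zero]
          · positivity
          intro i hi
          obtain ⟨p, hp, q, hq, h3, h4⟩ := hTP i hi
          have := hball p hp q hq
          have := hlong i ((mem_levelGaps.1 (hT hi)).2.trans_le
            (Nat.pow_le_pow_right two_pos hkn))
          linarith
        · refine (ho n hn k hkn T hT fun i hi j hj l hl hil => ?_).trans_eq ?_
          · obtain ⟨p, hp, -, -, h3, -⟩ := hTP i hi
            obtain ⟨-, -, q, hq, -, h4⟩ := hTP j hj
            have := hball p hp q hq
            have := hlong l hl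
            have := gapLeft_add_le ha o hil.1
            have := gapLeft_add_le ha o hil.2
            linarith [apply_nonneg ha i, apply_nonneg ha j]
          · obtain ⟨d, rfl⟩ := Nat.exists_eq_add_of_le hkn
            rw [Nat.add_sub_cancel_left, pow_add]
            field_simp)
    refine h2.trans ?_
    have h3 : 32 * ((n : ℝ) + 1) ^ 2 / 2 ^ n * 2 ^ (n + m) * (1 + D) =
        (32 + 32 * D) * ((n + 1) ^ 2 * 2 ^ m) := by
      rw [pow_add]; field_simp
    rw [h3]
    nlinarith
  have hle := (Metric.externalCoveringNumber_le_coveringNumber _ _).trans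
    ((Metric.coveringNumber_le_packingNumber _ _).trans hpack)
  refine (ENat.toENNReal_le.2 hle).trans ?_
  rw [ENat.toENNReal_coe, ← ENNReal.ofReal_natCast]
  exact ENNReal.ofReal_le_ofReal (Nat.floor_le (by positivity))

end Rearrangement

/-! ### Random labels -/

theorem labelMeasure_forall_mem (S : Finset ℕ+) {A : Set unitInterval} (hA : MeasurableSet A) :
    labelMeasure {ω | ∀ i ∈ S, ω i ∈ A} = volume A ^ S.card := by
  have := Measure.infinitePi_pi (fun _ : ℕ+ => (volume : Measure unitInterval)) (s := S)
    (t := fun _ => A) fun _ _ => hA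
  rw [Finset.prod_const] at this
  exact this

open scoped Classical in
/-- The number of labels in a set is unlikely to exceed `8` times its mean: choose `M` of the
labels, and use `(8 x) ^ M / M! ≤ exp (8 x)`, where `x` is the mean. -/
theorem labelMeasure_le_card_filter {S : Finset ℕ+} {A : Set unitInterval} (hA : MeasurableSet A)
    {p : ℝ} (hp : 0 ≤ p) (hAp : volume A ≤ ENNReal.ofReal p) {M : ℕ} (hM : 8 * (S.card * p) ≤ M) :
    labelMeasure {ω | M ≤ (S.filter fun i => ω i ∈ A).card} ≤ ENNReal.ofReal (Real.exp (-M)) := by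
  have h1 : {ω : ℕ+ → unitInterval | M ≤ (S.filter fun i => ω i ∈ A).card} ⊆
      ⋃ T ∈ S.powersetCard M, {ω | ∀ i ∈ T, ω i ∈ A} := by
    intro ω hω
    obtain ⟨T, hT, hcard⟩ := Finset.exists_subset_card_eq hω
    refine Set.mem_iUnion₂.2 ⟨T, Finset.mem_powersetCard.2
      ⟨hT.trans (Finset.filter_subset _ _), hcard⟩, fun i hi => (Finset.mem_filter.1 (hT hi)).2⟩
  have h2 : labelMeasure {ω | M ≤ (S.filter fun i => ω i ∈ A).card} ≤
      ENNReal.ofReal ((S.card.choose M) * p ^ M) := by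
    refine (measure_mono h1).trans ((measure_biUnion_finset_le _ _).trans ?_)
    calc _ ≤ ∑ T ∈ S.powersetCard M, ENNReal.ofReal (p ^ M) := by
          refine Finset.sum_le_sum fun T hT => ?_
          rw [labelMeasure_forall_mem T hA, (Finset.mem_powersetCard.1 hT).2,
            ENNReal.ofReal_pow hp]
          gcongr
      _ = _ := by
          rw [Finset.sum_const, Finset.card_powersetCard, nsmul_eq_mul,
            ENNReal.ofReal_mul (by positivity), ENNReal.ofReal_natCast]
  refine h2.trans (ENNReal.ofReal_le_ofReal ?_)
  have hx : 0 ≤ S.card * p := by positivity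
  calc (S.card.choose M : ℝ) * p ^ M ≤ (S.card : ℝ) ^ M / M.factorial * p ^ M := by
        gcongr; exact Nat.choose_le_pow_div M S.card
    _ = (8 * (S.card * p)) ^ M / M.factorial / 8 ^ M := by
        rw [mul_pow, mul_pow]; field_simp
    _ ≤ Real.exp (8 * (S.card * p)) / 8 ^ M := by
        gcongr; exact Real.pow_div_factorial_le_exp _ (by positivity) M
    _ ≤ Real.exp M / Real.exp (2 * M) := by
        have : Real.exp (2 * M) ≤ 8 ^ M := by
          rw [mul_comm, Real.exp_nat_mul]
          gcongr
          have h3 := Real.exp_one_lt_d9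
          have h4 := Real.exp_pos 1
          rw [← one_add_one_eq_two, Real.exp_add]
          nlinarith
        gcongr
    _ = Real.exp (-M) := by rw [← Real.exp_sub]; congr 1; ring

/-- The `q`-th of the `Q` closed intervals of length `1 / Q` into which `[0,1]` is divided. -/
def labelCell (Q q : ℕ) : Set unitInterval :=
  Subtype.val ⁻¹' Set.Icc ((q : ℝ) / Q) ((q + 1) / Q)

theorem measurableSet_labelCell (Q q : ℕ) : MeasurableSet (labelCell Q q) :=
  measurable_subtype_coe measurableSet_Icc

theorem volume_labelCell_le (Q q : ℕ) : volume (labelCell Q q) ≤ ENNReal.ofReal (1 / Q) := by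
  rw [unitInterval.volume_apply]
  refine (measure_mono (Set.image_preimage_subset _ _)).trans ?_
  rw [Real.volume_Icc]
  exact ENNReal.ofReal_le_ofReal (by rw [← sub_div]; simp)

theorem volume_labelCell {Q q : ℕ} (hq : q < Q) :
    volume (labelCell Q q) = ENNReal.ofReal (1 / Q) := by
  have hQ : (0 : ℝ) < Q := by exact_mod_cast (Nat.zero_le q).trans_lt hq
  have hq' : (q : ℝ) + 1 ≤ Q := by exact_mod_cast hq
  rw [unitInterval.volume_apply, labelCell, Set.image_preimage_eq_of_subset, Real.volume_Icc,
    ← sub_div]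
  · simp
  · rw [Subtype.range_coe_subtype]
    intro x hx
    exact ⟨(by positivity : (0 : ℝ) ≤ q / Q).trans hx.1, hx.2.trans ((div_le_one hQ).2 hq')⟩

theorem labelMeasure_forall_notMem_labelCell_le {Q q : ℕ} (hq : q < Q) (S : Finset ℕ+) :
    labelMeasure {ω | ∀ i ∈ S, ω i ∉ labelCell Q q} ≤
      ENNReal.ofReal (Real.exp (-(S.card / Q))) := by
  have h := labelMeasure_forall_mem S (measurableSet_labelCell Q q).compl
  have hQ : (1 : ℝ) ≤ Q := by exact_mod_cast Nat.one_le_of_lt hq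
  rw [prob_compl_eq_one_sub (measurableSet_labelCell Q q), volume_labelCell hq,
    ← ENNReal.ofReal_one, ← ENNReal.ofReal_sub _ (by positivity), ← ENNReal.ofReal_pow
      (by rw [sub_nonneg, div_le_one (by positivity)]; exact hQ)] at h
  refine h.le.trans (ENNReal.ofReal_le_ofReal ?_)
  have h1 : (1 : ℝ) - 1 / Q ≤ Real.exp (-(1 / Q)) := by
    have := Real.add_one_le_exp (-(1 / Q : ℝ)); linarith
  calc (1 - 1 / (Q : ℝ)) ^ S.card ≤ Real.exp (-(1 / Q)) ^ S.card := by
        gcongr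
        rw [sub_nonneg, div_le_one (by positivity)]; exact hQ
    _ = _ := by rw [← Real.exp_nat_mul]; congr 1; ring

/-- The number of cells at step `n`. It is a little smaller than `2 ^ n`, so that it is likely
that each cell contains one of the first `2 ^ n - 1` labels. -/
def numCells (n : ℕ) : ℕ := 2 ^ n / (n + 1) ^ 2

theorem sq_le_two_pow {n : ℕ} (hn : 6 ≤ n) : (n + 1) ^ 2 ≤ 2 ^ n := by
  induction n, hn using Nat.le_induction with
  | base => norm_num
  | succ n hn ih => rw [pow_succ 2]; nlinarith

theorem one_le_numCells {n : ℕ} (hn : 6 ≤ n) : 1 ≤ numCells n :=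
  (Nat.one_le_div_iff (by positivity)).2 (sq_le_two_pow hn)

theorem numCells_mul_le (n : ℕ) : (numCells n : ℝ) * (n + 1) ^ 2 ≤ 2 ^ n := by
  exact_mod_cast Nat.div_mul_le_self (2 ^ n) ((n + 1) ^ 2)

theorem numCells_le (n : ℕ) : numCells n ≤ 2 ^ n := Nat.div_le_self _ _

theorem le_numCells_mul {n : ℕ} (hn : 6 ≤ n) : (2 : ℝ) ^ n ≤ numCells n * (2 * (n + 1) ^ 2) := by
  have h1 := one_le_numCells hn
  have h2 := Nat.lt_div_mul_add (a := 2 ^ n) (b := (n + 1) ^ 2) (by positivity)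
  have h3 : 2 ^ n ≤ numCells n * (2 * (n + 1) ^ 2) := by
    change 2 ^ n < numCells n * (n + 1) ^ 2 + (n + 1) ^ 2 at h2
    nlinarith [sq_nonneg (n + 1)]
  exact_mod_cast h3

open scoped Classical in
/-- The labels that are badly distributed at step `n`: either some cell contains no label of a
step before `n`, or some cell contains far too many labels of a step `n + d`: the mean number is at
most `2 * (n + 1) ^ 2 * 2 ^ d`, and the threshold is `8` times that. Two cells beyond the end of
`[0,1]` are included, for use at the right end. -/
def badLabels (n : ℕ) : Set (ℕ+ → unitInterval) :=
  (⋃ q ∈ Finset.range (numCells n),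
    {ω | ∀ l ∈ Finset.Ico 1 ((2 : ℕ+) ^ n), ω l ∉ labelCell (numCells n) q}) ∪
  ⋃ d : ℕ, ⋃ q ∈ Finset.range (numCells n + 2),
    {ω | 16 * (n + 1) ^ 2 * 2 ^ d ≤
      ((levelGaps (n + d)).filter fun i => ω i ∈ labelCell (numCells n) q).card}

theorem two_pow_le_exp (n : ℕ) : (2 : ℝ) ^ n ≤ Real.exp n := by
  rw [← mul_one (n : ℝ), Real.exp_nat_mul]
  gcongr
  have := Real.add_one_le_exp (1 : ℝ)
  linarith

theorem labelMeasure_badLabels_le {n : ℕ} (hn : 6 ≤ n) :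
    labelMeasure (badLabels n) ≤
      ENNReal.ofReal (Real.exp (-n)) +
        ∑' d : ℕ, ENNReal.ofReal (Real.exp (-n) * Real.exp (-d)) := by
  classical
  have hn' : (6 : ℝ) ≤ n := by exact_mod_cast hn
  have hQ : (1 : ℝ) ≤ numCells n := by exact_mod_cast one_le_numCells hn
  have hQ2 : (numCells n : ℝ) ≤ 2 ^ n := by exact_mod_cast numCells_le n
  refine (measure_union_le _ _).trans (add_le_add ?_ ?_)
  · refine (measure_biUnion_finset_le _ _).trans ((Finset.sum_le_sum fun q hq =>
      labelMeasure_forall_notMem_labelCell_le (Finset.mem_range.1 hq) _).trans ?_)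
    rw [Finset.sum_const, Finset.card_range, nsmul_eq_mul, ← ENNReal.ofReal_natCast,
      ← ENNReal.ofReal_mul (by positivity)]
    refine ENNReal.ofReal_le_ofReal ?_
    have hcard : ((Finset.Ico 1 ((2 : ℕ+) ^ n)).card : ℝ) = 2 ^ n - 1 := by
      rw [PNat.card_Ico, PNat.pow_coe, PNat.val_ofNat, PNat.one_coe,
        Nat.cast_sub Nat.one_le_two_pow]
      simp
    have h1 : (2 : ℝ) ≤ 2 ^ n := by
      calc (2 : ℝ) = 2 ^ 1 := by norm_num
        _ ≤ 2 ^ n := pow_le_pow_right₀ (by norm_num) (by omega)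
    have h2 : 2 * (n : ℝ) ≤ ((Finset.Ico 1 ((2 : ℕ+) ^ n)).card : ℝ) / numCells n := by
      rw [hcard, le_div_iff₀ (by positivity)]
      have := numCells_mul_le n
      nlinarith
    calc _ ≤ Real.exp n * Real.exp (-(2 * n)) := by
          gcongr
          exact hQ2.trans (two_pow_le_exp n)
      _ = Real.exp (-n) := by rw [← Real.exp_add]; congr 1; ring
  · refine (measure_iUnion_le _).trans (ENNReal.tsum_le_tsum fun d => ?_)
    have hd : (d : ℝ) + 1 ≤ 2 ^ d := by exact_mod_cast Nat.lt_two_pow_self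
    refine (measure_biUnion_finset_le _ _).trans ((Finset.sum_le_sum fun q _ =>
      labelMeasure_le_card_filter (measurableSet_labelCell _ q) (by positivity)
        (volume_labelCell_le _ q) ?_).trans ?_)
    · rw [card_levelGaps]
      push_cast
      rw [mul_one_div, ← mul_div_assoc, div_le_iff₀ (by positivity), pow_add]
      have := le_numCells_mul hn
      have h2 : (0 : ℝ) < 2 ^ d := by positivity
      nlinarith
    · rw [Finset.sum_const, Finset.card_range, nsmul_eq_mul, ← ENNReal.ofReal_natCast,
        ← ENNReal.ofReal_mul (by positivity)]
      refine ENNReal.ofReal_le_ofReal ?_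
      have h3 : ((numCells n + 2 : ℕ) : ℝ) ≤ 2 ^ (n + 2) := by
        push_cast
        rw [pow_add]
        have : (1 : ℝ) ≤ 2 ^ n := one_le_pow₀ (by norm_num)
        linarith
      have h4 : ((n + 2 : ℕ) : ℝ) + n + d ≤ 16 * (n + 1) ^ 2 * 2 ^ d := by
        push_cast
        have h5 : 16 * ((n : ℝ) + 1) * (d + 1) ≤ 16 * (n + 1) ^ 2 * 2 ^ d := by
          gcongr
          nlinarith
        nlinarith
      calc _ ≤ Real.exp ((n + 2 : ℕ) : ℝ) * Real.exp (-(((n + 2 : ℕ) : ℝ) + n + d)) := by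
            gcongr
            · exact h3.trans (two_pow_le_exp _)
            · push_cast at h4 ⊢; exact h4
        _ = _ := by rw [← Real.exp_add, ← Real.exp_add]; congr 1; ring

theorem ae_eventually_notMem_badLabels :
    ∀ᵐ ω ∂labelMeasure, ∀ᶠ n in atTop, ω ∉ badLabels (n + 6) := by
  refine ae_eventually_notMem ?_
  have hs := Real.summable_exp_neg_nat
  set D := ∑' d : ℕ, Real.exp (-d)
  have hD : 0 ≤ D := tsum_nonneg fun _ => by positivity
  have h : ∀ n : ℕ, labelMeasure (badLabels (n + 6)) ≤
      ENNReal.ofReal (Real.exp (-n) * (1 + D)) := fun n => by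
    have hle : Real.exp (-((n + 6 : ℕ) : ℝ)) ≤ Real.exp (-n) := by
      rw [Real.exp_le_exp]; push_cast; linarith
    refine (labelMeasure_badLabels_le (by omega)).trans ?_
    rw [← ENNReal.ofReal_tsum_of_nonneg (fun d => by positivity) (hs.mul_left _), tsum_mul_left,
      ← ENNReal.ofReal_add (by positivity) (mul_nonneg (by positivity) hD)]
    refine ENNReal.ofReal_le_ofReal ?_
    calc _ = Real.exp (-((n + 6 : ℕ) : ℝ)) * (1 + D) := by rw [mul_add, mul_one]
      _ ≤ _ := by gcongr
  refine ne_top_of_le_ne_top ?_ (ENNReal.tsum_le_tsum h)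
  rw [← ENNReal.ofReal_tsum_of_nonneg (fun n => by positivity) (hs.mul_right _)]
  exact ENNReal.ofReal_ne_top

/-- Labels without a label of a step before `n` between them lie in two adjacent cells. -/
theorem card_le_of_notMem_badLabels {ω : ℕ+ → unitInterval} {n : ℕ} (hn : 6 ≤ n)
    (hω : ω ∉ badLabels n) {k : ℕ} (hk : n ≤ k) {T : Finset ℕ+} (hT : T ⊆ levelGaps k)
    (hsep : ∀ i ∈ T, ∀ j ∈ T, ∀ l : ℕ+, (l : ℕ) < 2 ^ n →
      ¬ ((orderOfLabels ω).1 i l ∧ (orderOfLabels ω).1 l j)) :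
    (T.card : ℝ) ≤ 32 * (n + 1) ^ 2 * 2 ^ (k - n) := by
  classical
  rcases T.eq_empty_or_nonempty with rfl | hne
  · simp only [Finset.card_empty, Nat.cast_zero]; positivity
  obtain ⟨d, rfl⟩ := Nat.exists_eq_add_of_le hk
  rw [Nat.add_sub_cancel_left]
  set Q := numCells n with hQdef
  have hQ : (0 : ℝ) < Q := by exact_mod_cast one_le_numCells hn
  simp only [badLabels, Set.mem_union, Set.mem_iUnion, Finset.mem_range, Set.mem_ofPred_eq,
    not_or, not_exists, not_forall, not_not, not_le] at hω
  obtain ⟨hhit, hcrowd⟩ := hω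
  obtain ⟨i₀, hi₀, hmin⟩ := T.exists_min_image ω hne
  set q := ⌊(ω i₀ : ℝ) * Q⌋₊ with hq
  have hω0 := (ω i₀).2
  have hq1 : (q : ℝ) ≤ ω i₀ * Q := Nat.floor_le (mul_nonneg hω0.1 hQ.le)
  have hq2 : (ω i₀ : ℝ) * Q < q + 1 := Nat.lt_floor_add_one _
  have hqQ : q ≤ Q := by
    have : (q : ℝ) ≤ Q := hq1.trans (mul_le_of_le_one_left hQ.le hω0.2)
    exact_mod_cast this
  have hupper : ∀ j ∈ T, (ω j : ℝ) ≤ (q + 2) / Q := fun j hj => by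
    rcases lt_or_ge (q + 1) Q with h | h
    · by_contra! hlt
      obtain ⟨l, hl, hlc⟩ := hhit (q + 1) h
      have hl2 : (l : ℕ) < 2 ^ n := by
        have := PNat.coe_lt_coe _ _ |>.2 (Finset.mem_Ico.1 hl).2
        simpa using this
      have hl1 : ((q + 1 : ℕ) : ℝ) / Q ≤ ω l ∧ (ω l : ℝ) ≤ (((q + 1 : ℕ) : ℝ) + 1) / Q := hlc
      refine hsep i₀ hi₀ j hj l hl2 ⟨Or.inl ?_, Or.inl ?_⟩
      · refine Subtype.coe_lt_coe.1 (lt_of_lt_of_le ?_ hl1.1)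
        rw [lt_div_iff₀ hQ]; push_cast; exact hq2
      · refine Subtype.coe_lt_coe.1 (hl1.2.trans_lt ?_)
        push_cast
        rwa [add_assoc, one_add_one_eq_two]
    · refine (ω j).2.2.trans ((one_le_div hQ).2 ?_)
      have : (Q : ℝ) ≤ q + 1 := by exact_mod_cast h
      linarith
  have hsub : T ⊆ ((levelGaps (n + d)).filter fun i => ω i ∈ labelCell Q q) ∪
      ((levelGaps (n + d)).filter fun i => ω i ∈ labelCell Q (q + 1)) := by
    intro j hj
    have h1 : (ω i₀ : ℝ) ≤ ω j := hmin j hj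
    have h2 := hupper j hj
    rw [Finset.mem_union, Finset.mem_filter, Finset.mem_filter]
    rcases le_total (ω j : ℝ) ((q + 1) / Q) with h | h
    · exact Or.inl ⟨hT hj, (div_le_iff₀ hQ).2 (hq1.trans (by gcongr)), h⟩
    · refine Or.inr ⟨hT hj, ?_, ?_⟩
      · push_cast; exact h
      · push_cast; rwa [add_assoc, one_add_one_eq_two]
  have h1 := (Finset.card_le_card hsub).trans (Finset.card_union_le _ _)
  have h2 := hcrowd d q (by omega)
  have h3 := hcrowd d (q + 1) (by omega)
  have h4 : T.card ≤ 32 * (n + 1) ^ 2 * 2 ^ d := by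
    refine h1.trans ((add_le_add h2.le h3.le).trans_eq ?_)
    ring
  exact_mod_cast h4

theorem ae_balancedOrder_orderOfLabels :
    ∀ᵐ ω ∂labelMeasure, BalancedOrder (orderOfLabels ω) := by
  filter_upwards [ae_eventually_notMem_badLabels] with ω hω
  obtain ⟨n₀, hn₀⟩ := eventually_atTop.1 hω
  refine ⟨n₀ + 6, fun n hn k hk T hT hsep => ?_⟩
  obtain ⟨m, rfl⟩ := Nat.exists_eq_add_of_le' (show 6 ≤ n by omega)
  exact card_le_of_notMem_badLabels (by omega) (hn₀ m (by omega)) hk hT hsep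

/-! ### Measurability in the space of orders -/

theorem measurableSet_rel (i j : ℕ+) : MeasurableSet {o : OrderSpace | o.1 i j} := by
  classical
  rcases Set.eq_empty_or_nonempty {o : OrderSpace | o.1 i j} with h | ⟨o₀, ho₀⟩
  · rw [h]; exact MeasurableSet.empty
  refine MeasurableSpace.measurableSet_generateFrom
    ⟨{i, j}, fun x y => o₀.1 x y, ?_, Set.ext fun o => ?_⟩
  · exact { trichotomous := fun x y h h' => Subtype.ext (o₀.2.trichotomous _ _ h h')
            irrefl := fun x => o₀.2.irrefl _
            trans := fun x y z => o₀.2.trans _ _ _ }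
  · have ho₀ : o₀.1 i j := ho₀
    constructor
    · rintro (h : o.1 i j) ⟨x, hx⟩ ⟨y, hy⟩
      simp only [Finset.mem_insert, Finset.mem_singleton] at hx hy
      rcases hx with rfl | rfl <;> rcases hy with rfl | rfl
      · exact iff_of_false (o.2.irrefl _) (o₀.2.irrefl _)
      · exact iff_of_true h ho₀
      · exact iff_of_false (not_lt_and_lt o h) (not_lt_and_lt o₀ ho₀)
      · exact iff_of_false (o.2.irrefl _) (o₀.2.irrefl _)
    · intro h
      exact (h ⟨i, by simp⟩ ⟨j, by simp⟩).2 ho₀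

theorem measurableSet_balancedOrder : MeasurableSet {o | BalancedOrder o} := by
  have hrel : ∀ i j : ℕ+, Measurable fun o : OrderSpace => o.1 i j := fun i j =>
    measurableSet_setOfPred.1 (measurableSet_rel i j)
  refine measurableSet_setOfPred.2 (Measurable.exists fun n₀ => Measurable.forall fun n =>
    Measurable.forall fun _ => Measurable.forall fun k => Measurable.forall fun _ =>
    Measurable.forall fun T => Measurable.forall fun _ => Measurable.imp ?_ measurable_const)
  exact Measurable.forall fun i => Measurable.forall fun _ => Measurable.forall fun j =>
    Measurable.forall fun _ => Measurable.forall fun l => Measurable.forall fun _ =>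
    ((hrel i l).and (hrel l j)).not

theorem ae_balancedOrder : ∀ᵐ o ∂orderMeasure, BalancedOrder o :=
  (ae_map_iff measurable_orderOfLabels.aemeasurable measurableSet_balancedOrder).2
    ae_balancedOrder_orderOfLabels

end RandomRearrangement

theorem theorem4p1 (a : ℕ → ℝ) (ha : RandomRearrangement.IsLevelComparable a)
    (Φ : ℝ → ℝ) (hΦ : RandomRearrangement.IsDimensionFunction Φ) :
    ((fun x : ℝ => Real.log |Real.log x| / |Real.log x|) =o[𝓝[>] 0] Φ ↔
      (fun n : ℕ => Real.log n) =o[atTop]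
        (fun n : ℕ => (RandomRearrangement.depth a Φ n : ℝ))) ∧
    ((fun x : ℝ => Real.log |Real.log x| / |Real.log x|) =o[𝓝[>] 0] Φ →
      ∀ᵐ o ∂(RandomRearrangement.orderMeasure),
        RandomRearrangement.upperDim Φ (RandomRearrangement.rearrangement a o) =
          RandomRearrangement.upperDim Φ (RandomRearrangement.cantorSet a)) := by
  obtain ⟨τ, lam, hb⟩ := ha.exists_levelBounds
  refine ⟨hb.isLittleO_iff_depth hΦ, fun h => ?_⟩
  have hlarge := hΦ.isLittleO_iff.1 h
  filter_upwards [RandomRearrangement.ae_balancedOrder] with o ho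
  exact le_antisymm
    (hb.upperDim_le hlarge (RandomRearrangement.coverLower_cantorSet ha hb)
      (RandomRearrangement.coverUpper_rearrangement ha hb ho))
    (hb.upperDim_le hlarge (RandomRearrangement.coverLower_rearrangement ha o hb)
      (RandomRearrangement.coverUpper_cantorSet ha hb))
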